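/- **Definitions.** An index is a finite tuple $\boldsymbol{k}=(k_1,\dots,k_r)$ of positive integers; it is admissible if it is empty or $k_r\ge 2$. For $n\ge 1$ let $\mathcal{A}_n=\prod_p \mathbb{Z}/p^n\mathbb{Z}\,\big/\,\bigoplus_p\mathbb{Z}/p^n\mathbb{Z}$ ($p$ running over all primes), a $\mathbb{Q}$-algebra, and $$\zeta_{\mathcal{A}_n}(\boldsymbol{k})=\Bigl(\sum_{0<n_1<\cdots<n_r<p}\frac{1}{n_1^{k_1}\cdots n_r^{k_r}}\bmod p^n\Bigr)_p,\qquad \zeta^{\star}_{\mathcal{A}_n}(\boldsymbol{k})=\Bigl(\sum_{1\le n_1\le\cdots\le n_r\le p-1}\frac{1}{n_1^{k_1}\cdots n_r^{k_r}}\bmod p^n\Bigr)_p .$$ For admissible $\boldsymbol{k}$ let $\zeta(\boldsymbol{k})=\sum_{0<n_1<\cdots<n_r}n_1^{-k_1}\cdots n_r^{-k_r}$ (with $\zeta(\varnothing)=1$), let $\mathcal{Z}\subset\mathbb{R}$ be the $\mathbb{Q}$-algebra generated by these values, and $\overline{\mathcal{Z}}=\mathcal{Z}/\zeta(2)\mathcal{Z}$.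 For an arbitrary index let $\zeta^{*}(\boldsymbol{k})\in\mathcal{Z}$ be its harmonic regularization: on the $\mathbb{Q}$-space spanned by words $e_{\boldsymbol{k}}=e_{k_1}\cdots e_{k_r}$, with the harmonic product $*$ (bilinear, with unit $1=e_\varnothing$, and $e_aw*e_bw'=e_a(w*e_bw')+e_b(e_aw*w')+e_{a+b}(w*w')$), write $e_{\boldsymbol{k}}=\sum_i a_i*e_1^{*i}$ uniquely with every $a_i$ a linear combination of words of admissible indices; then $\zeta^*(\boldsymbol{k})=Z(a_0)$, where $Z$ is linear with $Z(e_{\boldsymbol{l}})=\zeta(\boldsymbol{l})$ for admissible $\boldsymbol{l}$. Let $\zeta_{\widehat{\mathcal S}}(\boldsymbol{k})\in\overline{\mathcal{Z}}[[t]]$ be the reduction modulo $\zeta(2)$ of $$\sum_{i=0}^r(-1)^{k_{i+1}+\cdots+k_r}\zeta^*(k_1,\dots,k_i)\sum_{l_{i+1},\dots,l_r\ge0}\Bigl[\prod_{j=i+1}^r\binom{k_j+l_j-1}{l_j}\Bigr]\zeta^*(k_r+l_r,\dots,k_{i+1}+l_{i+1})\,t^{l_{i+1}+\cdots+l_r},$$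 and $\zeta^{\star}_{\widehat{\mathcal S}}(\boldsymbol{k})=\sum\zeta_{\widehat{\mathcal S}}(k_1\square\cdots\square k_r)$, where each $\square$ is either a comma or a plus sign. Let $\zeta_{\mathcal{S}_n}(\boldsymbol{k})$ and $\zeta^\star_{\mathcal{S}_n}(\boldsymbol{k})$ be the images of these in $\overline{\mathcal{Z}}[[t]]/(t^n)$. Put $x_{\mathcal{A}_n}=(p\bmod p^n)_p$ and $x_{\mathcal{S}_n}=t\bmod t^n$. For $k\ge2$ put $$\mathfrak{Z}_{\mathcal{A}_n}(k)=\Bigl(\frac{B_{p^{n-1}(p-1)-k+1}}{k-1+p^{n-1}}\bmod p^n\Bigr)_p,\qquad \mathfrak{Z}_{\mathcal{S}_n}(k)=\zeta(k)\bmod\zeta(2),$$ where $B_j$ is the $j$-th Bernoulli number. (Elements of $\mathcal{A}_n$ need to be given only for all but finitely many $p$.) Write $\{k\}^r$ for $k,\dots,k$ ($r$ times). **Theorem.** For all positive integers $r,k$ and for $\mathcal{F}\in\{\mathcal{A},\mathcal{S}\}$, $$\zeta_{\mathcal{F}_2}(\{k\}^r)=(-1)^{r-1}k\,\mathfrak{Z}_{\mathcal{F}_2}(rk+1)\,x_{\mathcal{F}_2},\qquad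 \zeta^{\star}_{\mathcal{F}_2}(\{k\}^r)=k\,\mathfrak{Z}_{\mathcal{F}_2}(rk+1)\,x_{\mathcal{F}_2}.$$ Moreover, $$\zeta_{\mathcal{F}_3}(\{k\}^r)=(-1)^{rk+r-1}\Bigl[k\mathfrak{Z}_{\mathcal{F}_3}(rk+1)x_{\mathcal{F}_3}+\Bigl\{\tfrac{k(rk+1)}{2}\mathfrak{Z}_{\mathcal{F}_3}(rk+2)-\tfrac{k^2}{2}\sum_{l=1}^{r-1}\mathfrak{Z}_{\mathcal{F}_3}(lk+1)\mathfrak{Z}_{\mathcal{F}_3}((r-l)k+1)\Bigr\}x_{\mathcal{F}_3}^2\Bigr],$$ $$\zeta^{\star}_{\mathcal{F}_3}(\{k\}^r)=(-1)^{rk}\Bigl[k\mathfrak{Z}_{\mathcal{F}_3}(rk+1)x_{\mathcal{F}_3}+\Bigl\{\tfrac{k(rk+1)}{2}\mathfrak{Z}_{\mathcal{F}_3}(rk+2)+\tfrac{k^2}{2}\sum_{l=1}^{r-1}\mathfrak{Z}_{\mathcal{F}_3}(lk+1)\mathfrak{Z}_{\mathcal{F}_3}((r-l)k+1)\Bigr\}x_{\mathcal{F}_3}^2\Bigr].$$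 -/

import Mathlib

noncomputable section

open scoped Classical

namespace FMZV

/-! Indices are lists of positive integers, `[k₁, …, k_r]`. -/

/-! ### The rings `𝒜_n` and the `𝒜_n`-multiple zeta(-star) values -/

/-- The ideal `⨁_p ℤ/pⁿℤ` of `∏_p ℤ/pⁿℤ`. -/
def finiteSupportIdeal (n : ℕ) : Ideal ((p : Nat.Primes) → ZMod ((p : ℕ) ^ n)) where
  carrier := {f | {p | f p ≠ 0}.Finite}
  add_mem' {f g} hf hg := (hf.union hg).subset fun p hp => by
    by_contra h
    simp only [Set.mem_union, Set.mem_ofPred_eq, not_or, not_not] at h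
    exact hp (by simp [h.1, h.2])
  zero_mem' := by simp
  smul_mem' c f hf := hf.subset fun p hp h => hp (by simp [h])

/-- `𝒜_n = (∏_p ℤ/pⁿℤ) / (⨁_p ℤ/pⁿℤ)`. -/
abbrev ARing (n : ℕ) : Type :=
  ((p : Nat.Primes) → ZMod ((p : ℕ) ^ n)) ⧸ finiteSupportIdeal n

/-- The class in `𝒜_n` of a family of residues modulo `pⁿ`. -/
def ARing.mk (n : ℕ) (f : (p : Nat.Primes) → ZMod ((p : ℕ) ^ n)) : ARing n :=
  Ideal.Quotient.mk (finiteSupportIdeal n) f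

/-- A nonzero integer is invertible modulo `pⁿ` for all but finitely many primes `p`. -/
theorem ARing.isUnit_intCast (n : ℕ) (m : nonZeroDivisors ℤ) :
    IsUnit (Int.castRingHom (ARing n) m) := by
  have hm : (m : ℤ) ≠ 0 := nonZeroDivisors.coe_ne_zero m
  refine IsUnit.of_mul_eq_one (ARing.mk n fun p => ((m : ℤ) : ZMod ((p : ℕ) ^ n))⁻¹) ?_
  have h1 : Int.castRingHom (ARing n) m =
      Ideal.Quotient.mk (finiteSupportIdeal n) (fun p => ((m : ℤ) : ZMod ((p : ℕ) ^ n))) := by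
    rw [eq_intCast, ← map_intCast (Ideal.Quotient.mk (finiteSupportIdeal n)) (m : ℤ)]
    rfl
  rw [h1, ARing.mk, ← map_mul, ← map_one (Ideal.Quotient.mk (finiteSupportIdeal n)),
    Ideal.Quotient.mk_eq_mk_iff_sub_mem]
  have hfin : {p : Nat.Primes | (p : ℕ) ∣ (m : ℤ).natAbs}.Finite := by
    refine Set.Finite.of_finite_image (f := fun p : Nat.Primes => (p : ℕ)) ?_
      (fun a _ b _ h => Subtype.ext h)
    refine (Set.finite_le_nat (m : ℤ).natAbs).subset ?_
    rintro _ ⟨p, hp, rfl⟩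
    exact Nat.le_of_dvd (Int.natAbs_pos.mpr hm) hp
  refine hfin.subset fun p hp => ?_
  by_contra hdvd
  apply hp
  have hu : IsUnit ((m : ℤ) : ZMod ((p : ℕ) ^ n)) := by
    rw [ZMod.coe_int_isUnit_iff_isCoprime, Int.isCoprime_iff_gcd_eq_one, Int.gcd_comm]
    have hc : Nat.Coprime ((p : ℕ) ^ n) (m : ℤ).natAbs :=
      Nat.Coprime.pow_left n ((Nat.Prime.coprime_iff_not_dvd p.2).mpr hdvd)
    simpa [Int.gcd, Int.natAbs_pow, Nat.coprime_comm] using hc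
  simp [ZMod.mul_inv_of_unit _ hu]

/-- `𝒜_n` is a `ℚ`-algebra. -/
instance ARing.algebraRat (n : ℕ) : Algebra ℚ (ARing n) :=
  (IsLocalization.lift (M := nonZeroDivisors ℤ) (S := ℚ) (ARing.isUnit_intCast n)).toAlgebra

/-- `ζ_{𝒜_n}(k₁, …, k_r)`: the class of
`∑_{0 < n₁ < ⋯ < n_r < p} 1 / (n₁^{k₁} ⋯ n_r^{k_r}) mod pⁿ`
(each `n_i` is invertible modulo `pⁿ`, so that `⁻¹` is its inverse). -/
def zetaA (n : ℕ) (k : List ℕ+) : ARing n :=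
  ARing.mk n fun p =>
    ∑ m ∈ (Fintype.piFinset fun _ : Fin k.length => Finset.Ioo 0 (p : ℕ)) with StrictMono m,
      ∏ i, ((m i : ZMod ((p : ℕ) ^ n))⁻¹) ^ (k.get i : ℕ)

/-- `ζ^⋆_{𝒜_n}(k₁, …, k_r)`: the class of
`∑_{1 ≤ n₁ ≤ ⋯ ≤ n_r ≤ p - 1} 1 / (n₁^{k₁} ⋯ n_r^{k_r}) mod pⁿ`. -/
def zetaStarA (n : ℕ) (k : List ℕ+) : ARing n :=
  ARing.mk n fun p =>
    ∑ m ∈ (Fintype.piFinset fun _ : Fin k.length => Finset.Ioo 0 (p : ℕ)) with Monotone m,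
      ∏ i, ((m i : ZMod ((p : ℕ) ^ n))⁻¹) ^ (k.get i : ℕ)

/-- Reduction modulo `N` of a rational number whose denominator is prime to `N`. -/
def ratMod (N : ℕ) (q : ℚ) : ZMod N := (q.num : ZMod N) * (q.den : ZMod N)⁻¹

/-- `𝔷_{𝒜_n}(k)`: the class of `B_{p^{n-1}(p-1)-k+1} / (k-1+p^{n-1}) mod pⁿ`; for `k ≥ 2`
this rational number is `p`-integral and the index of `B` is nonnegative for all but finitely
many `p`. -/
def depthOneA (n k : ℕ) : ARing n :=
  ARing.mk n fun p => ratMod ((p : ℕ) ^ n)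
    (bernoulli ((p : ℕ) ^ (n - 1) * ((p : ℕ) - 1) + 1 - k) /
      ((k : ℚ) - 1 + (p : ℚ) ^ (n - 1)))

/-- `x_{𝒜_n} = (p mod pⁿ)_p`. -/
def xA (n : ℕ) : ARing n := ARing.mk n fun p => ((p : ℕ) : ZMod ((p : ℕ) ^ n))

/-! ### Multiple zeta values and their harmonic regularization -/

/-- An index is admissible when it is empty or its last entry is at least `2`. -/
def Admissible (k : List ℕ+) : Prop := ∀ a ∈ k.getLast?, 2 ≤ a

/-- `ζ(k₁, …, k_r) = ∑_{0 < n₁ < ⋯ < n_r} 1 / (n₁^{k₁} ⋯ n_r^{k_r})`. -/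
def mzv (k : List ℕ+) : ℝ :=
  ∑' m : {m : Fin k.length → ℕ // StrictMono m ∧ ∀ i, 0 < m i},
    ∏ i, 1 / ((m.1 i : ℝ) ^ (k.get i : ℕ))

/-- `𝒵`: the `ℚ`-subalgebra of `ℝ` generated by the multiple zeta values. -/
def mzvAlgebra : Subalgebra ℚ ℝ :=
  Algebra.adjoin ℚ {x | ∃ k : List ℕ+, Admissible k ∧ x = mzv k}

/-- `ζ(k)` as an element of `𝒵`, for admissible `k` (and `0` for other `k`). -/
def mzvElem (k : List ℕ+) : mzvAlgebra :=
  if h : Admissible k then ⟨mzv k, Algebra.subset_adjoin ⟨k, h, rfl⟩⟩ else 0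

/-- `ℌ¹`, the `ℚ`-vector space with basis the words `e_{k₁} ⋯ e_{k_r}`. -/
abbrev H1 : Type := List ℕ+ →₀ ℚ

/-- The word `e_{k₁} ⋯ e_{k_r}`. -/
def word (k : List ℕ+) : H1 := Finsupp.single k 1

/-- `ℌ⁰`, the span of the words of admissible indices. -/
def H0 : Submodule ℚ H1 := Submodule.span ℚ {w | ∃ k, Admissible k ∧ w = word k}

/-- Left concatenation `w ↦ e_a w`. -/
def prepend (a : ℕ+) : H1 →ₗ[ℚ] H1 := Finsupp.lmapDomain ℚ ℚ (List.cons a)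

/-- The harmonic product of two words. -/
def harmonicWord : List ℕ+ → List ℕ+ → H1
  | [], v => word v
  | a :: u, [] => word (a :: u)
  | a :: u, b :: v =>
      prepend a (harmonicWord u (b :: v)) + prepend b (harmonicWord (a :: u) v) +
        prepend (a + b) (harmonicWord u v)
termination_by u v => u.length + v.length

/-- The harmonic product on `ℌ¹`, the bilinear extension of `harmonicWord`. -/
def harmonicMul (f g : H1) : H1 :=
  f.sum fun u x => g.sum fun v y => (x * y) • harmonicWord u v

/-- The powers of `e₁` for the harmonic product. -/
def harmonicPowE1 : ℕ → H1
  | 0 => word []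
  | i + 1 => harmonicMul (harmonicPowE1 i) (word [1])

/-- `b` is the constant term of an expression `a = ∑ᵢ aᵢ * e₁^{*i}` with all `aᵢ` in `ℌ⁰`. -/
def IsHarmonicReg (a b : H1) : Prop :=
  ∃ (N : ℕ) (c : ℕ → H1), (∀ i, c i ∈ H0) ∧
    a = ∑ i ∈ Finset.range (N + 1), harmonicMul (c i) (harmonicPowE1 i) ∧ b = c 0

/-- `reg_*(a)`, the constant term of the unique expression `a = ∑ᵢ aᵢ * e₁^{*i}` with all `aᵢ`
in `ℌ⁰`. -/
def harmonicReg (a : H1) : H1 := Classical.epsilon (IsHarmonicReg a)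

/-- The linear map `Z` with `Z(e_{k₁} ⋯ e_{k_r}) = ζ(k₁, …, k_r)` on `ℌ⁰`. -/
def evalZ : H1 →ₗ[ℚ] mzvAlgebra := Finsupp.linearCombination ℚ mzvElem

/-- The harmonic regularized multiple zeta value `ζ^*(k) = Z(reg_*(e_k))`. -/
def zetaReg (k : List ℕ+) : mzvAlgebra := evalZ (harmonicReg (word k))

/-! ### The `𝒮_n`-multiple zeta(-star) values -/

/-- The index `(k₁ + l₁, …, k_r + l_r)`. -/
def shiftIndex (k : List ℕ+) (l : Fin k.length → ℕ) : List ℕ+ :=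
  List.ofFn fun j => ⟨(k.get j : ℕ) + l j, Nat.add_pos_left (k.get j).pos _⟩

/-- The power series `∑_{l₁, …, l_s ≥ 0} [∏_j binom(k_j + l_j - 1, l_j)]
ζ^*(k_s + l_s, …, k₁ + l₁) t^{l₁ + ⋯ + l_s}`. -/
def shiftedReversedSeries (k : List ℕ+) : PowerSeries mzvAlgebra :=
  PowerSeries.mk fun d => ∑ l ∈ Finset.Nat.antidiagonalTuple k.length d,
    ((∏ j, ((k.get j : ℕ) + l j - 1).choose (l j) : ℕ) : mzvAlgebra) *
      zetaReg (shiftIndex k l).reverse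

/-- `ζ^*_{Ŝ}(k₁, …, k_r) = ∑_{i=0}^r (-1)^{k_{i+1} + ⋯ + k_r} ζ^*(k₁, …, k_i)
∑_{l_{i+1}, …, l_r ≥ 0} [∏_{j>i} binom(k_j + l_j - 1, l_j)]
ζ^*(k_r + l_r, …, k_{i+1} + l_{i+1}) t^{l_{i+1} + ⋯ + l_r}`, an element of `𝒵⟦t⟧`. -/
def zetaHatReg (k : List ℕ+) : PowerSeries mzvAlgebra :=
  ∑ i ∈ Finset.range (k.length + 1),
    (-1) ^ (((k.drop i).map fun a : ℕ+ => (a : ℕ)).sum) *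
      PowerSeries.C (zetaReg (k.take i)) * shiftedReversedSeries (k.drop i)

/-- `𝒵̄ = 𝒵 / ζ(2)𝒵`. -/
abbrev ZBar : Type := mzvAlgebra ⧸ Ideal.span {mzvElem [2]}

/-- `ζ_{Ŝ}(k) = ζ^*_{Ŝ}(k) mod ζ(2)`, an element of `𝒵̄⟦t⟧`. -/
def zetaHat (k : List ℕ+) : PowerSeries ZBar :=
  PowerSeries.map (Ideal.Quotient.mk (Ideal.span {mzvElem [2]})) (zetaHatReg k)

/-- All indices `(k₁ □ ⋯ □ k_r)`, where each `□` is a comma or a plus. -/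
def commaPlus : List ℕ+ → List (List ℕ+)
  | [] => [[]]
  | [a] => [[a]]
  | a :: b :: k => ((commaPlus (b :: k)).map fun l => a :: l) ++ commaPlus ((a + b) :: k)
termination_by k => k.length

/-- `ζ^⋆_{Ŝ}(k₁, …, k_r)`, the sum of all `ζ_{Ŝ}(k₁ □ ⋯ □ k_r)`. -/
def zetaStarHat (k : List ℕ+) : PowerSeries ZBar := ((commaPlus k).map zetaHat).sum

/-- `𝒵̄⟦t⟧ / (tⁿ)`. -/
abbrev SRing (n : ℕ) : Type :=
  PowerSeries ZBar ⧸ Ideal.span {(PowerSeries.X : PowerSeries ZBar) ^ n}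

/-- The projection `π_n : 𝒵̄⟦t⟧ → 𝒵̄⟦t⟧ / (tⁿ)`. -/
def SRing.proj (n : ℕ) : PowerSeries ZBar →+* SRing n := Ideal.Quotient.mk _

/-- `ζ_{𝒮_n}(k)`. -/
def zetaS (n : ℕ) (k : List ℕ+) : SRing n := SRing.proj n (zetaHat k)

/-- `ζ^⋆_{𝒮_n}(k)`. -/
def zetaStarS (n : ℕ) (k : List ℕ+) : SRing n := SRing.proj n (zetaStarHat k)

/-- `𝔷_{𝒮_n}(k) = ζ(k) mod ζ(2)`, for `k ≥ 2`. -/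
def depthOneS (n k : ℕ) : SRing n :=
  SRing.proj n (PowerSeries.C (Ideal.Quotient.mk _ (mzvElem [k.toPNat'])))

/-- `x_{𝒮_n} = t mod tⁿ`. -/
def xS (n : ℕ) : SRing n := SRing.proj n PowerSeries.X

end FMZV

end

/-! For a fixed `k`, `ζ({k}^r)` and `ζ^⋆({k}^r)` play the roles of the elementary and complete
symmetric functions `e_r`, `h_r` in the `k`-th powers of the underlying variables, and the depth-one
values `P_j = ζ(jk)` play that of the power sums. So Newton's identities and `E(-T) H(T) = 1` hold
(`newton_quasiSum`, `sum_quasiSum_mul_quasiSumStar`). Formally `E(T) = exp(∑ (-1)^{j-1} q_j T^j)`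
and `H(T) = exp(∑ q_j T^j)` with `q_j = P_j / j`.

In depth one, with `x³ = 0`, both families satisfy `2 ζ(a) = (-1)^a (2a 𝔷(a+1) x + a(a+1) 𝔷(a+2)
x²)`. Every `q_j` is thus a multiple of `x`, triple products vanish, and both exponentials stop at
their quadratic terms: `e_r = (-1)^{r-1} (q_r - ½ ∑ q_l q_{r-l})` and `h_r = q_r + ½ ∑ q_l q_{r-l}`.
Substituting the depth-one formula gives the theorem (`closed_form_of_sq_eq_zero`,
`closed_form_of_cube_eq_zero`).

For `𝒜` the variables are the inverses of `1, …, p - 1`. Euler's theorem turns inverse powers into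
positive powers, and Faulhaber's formula with von Staudt–Clausen evaluates the power sums
(`two_mul_sum_inv_pow`).

For `𝒮` the variables are `1, 1/2, …, 1/N, 1/(t-N), …, 1/(t-1)`. Truncated sums at these points are,
coefficient by coefficient in `t`, polynomials in the harmonic number `H_N` up to an error smaller
than every power of `H_N`, and `ζ^*_Ŝ` is the constant term in `H_N` (`hasConstTerm_zetaHatReg`).
Such expansions are unique and compatible with sums and products, so identities among
quasi-symmetric functions pass to `ζ^*_Ŝ`. Modulo `ζ(2)` the even zeta values vanish, which gives
the depth-one formula. -/

noncomputable section

namespace FMZV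

/-! ### Quasi-symmetric sums over a list -/

/-- The monomial quasi-symmetric function `M_k` evaluated at a finite list of variables. -/
def quasiSum {R : Type*} [CommRing R] : List ℕ+ → List R → R
  | [], _ => 1
  | _ :: _, [] => 0
  | a :: u, x :: xs => x ^ (a : ℕ) * quasiSum u xs + quasiSum (a :: u) xs

/-- The variant of `quasiSum` in which variables may be repeated. -/
def quasiSumStar {R : Type*} [CommRing R] : List ℕ+ → List R → R
  | [], _ => 1
  | _ :: _, [] => 0
  | a :: u, x :: xs => x ^ (a : ℕ) * quasiSumStar u (x :: xs) + quasiSumStar (a :: u) xs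
termination_by u xs => u.length + xs.length

section QuasiSum

variable {R : Type*} [CommRing R]

@[simp]
theorem quasiSum_nil (xs : List R) : quasiSum [] xs = 1 := by
  cases xs <;> rfl

@[simp]
theorem quasiSum_cons_nil (a : ℕ+) (u : List ℕ+) : quasiSum (a :: u) ([] : List R) = 0 := rfl

theorem quasiSum_cons_cons (a : ℕ+) (u : List ℕ+) (x : R) (xs : List R) :
    quasiSum (a :: u) (x :: xs) = x ^ (a : ℕ) * quasiSum u xs + quasiSum (a :: u) xs := rfl

@[simp]
theorem quasiSumStar_nil (xs : List R) : quasiSumStar [] xs = 1 := by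
  rw [quasiSumStar]

@[simp]
theorem quasiSumStar_cons_nil (a : ℕ+) (u : List ℕ+) :
    quasiSumStar (a :: u) ([] : List R) = 0 := by
  rw [quasiSumStar]

theorem quasiSumStar_cons_cons (a : ℕ+) (u : List ℕ+) (x : R) (xs : List R) :
    quasiSumStar (a :: u) (x :: xs) =
      x ^ (a : ℕ) * quasiSumStar u (x :: xs) + quasiSumStar (a :: u) xs := by
  rw [quasiSumStar]

theorem quasiSum_map {S : Type*} [CommRing S] (f : R →+* S) (u : List ℕ+) (xs : List R) :
    quasiSum u (xs.map f) = f (quasiSum u xs) := by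
  induction xs generalizing u with
  | nil => cases u <;> simp
  | cons x xs ih =>
    cases u with
    | nil => simp
    | cons a u => simp [quasiSum_cons_cons, ih]

theorem quasiSum_singleton (a : ℕ+) (xs : List R) :
    quasiSum [a] xs = (xs.map fun x => x ^ (a : ℕ)).sum := by
  induction xs with
  | nil => rfl
  | cons x xs ih => simp [quasiSum_cons_cons, ih]

theorem quasiSum_concat_concat (u : List ℕ+) (a : ℕ+) (xs : List R) (x : R) :
    quasiSum (u ++ [a]) (xs ++ [x]) =
      quasiSum u xs * x ^ (a : ℕ) + quasiSum (u ++ [a]) xs := by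
  induction xs generalizing u with
  | nil =>
    cases u with
    | nil => simp [quasiSum_cons_cons]
    | cons b u => cases u <;> simp [quasiSum_cons_cons]
  | cons y xs ih =>
    cases u with
    | nil =>
      have := ih []
      simp only [List.nil_append, quasiSum_nil, List.cons_append, quasiSum_cons_cons] at this ⊢
      rw [this]; ring
    | cons b u =>
      have h1 := ih u
      have h2 := ih (b :: u)
      simp only [List.cons_append, quasiSum_cons_cons] at h2 ⊢
      rw [h1, h2]; ring

theorem quasiSum_reverse (u : List ℕ+) (xs : List R) :
    quasiSum u.reverse xs.reverse = quasiSum u xs := by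
  induction xs generalizing u with
  | nil =>
    rcases u with _ | ⟨a, u⟩
    · simp
    · rw [List.reverse_nil, quasiSum_cons_nil]
      cases h : (a :: u).reverse with
      | nil => simp at h
      | cons b v => rfl
  | cons x xs ih =>
    cases u with
    | nil => simp
    | cons a u =>
      have h := ih (a :: u)
      simp only [List.reverse_cons] at h ⊢
      rw [quasiSum_concat_concat, ih, h, quasiSum_cons_cons, mul_comm]

/-- The deconcatenation coproduct: the increasing choice of variables passes from `xs` to `ys` at
one position of the index. This is the source of the sum over `i` in `zetaHatReg`. -/
theorem quasiSum_append (u : List ℕ+) (xs ys : List R) :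
    quasiSum u (xs ++ ys) =
      ∑ i ∈ Finset.range (u.length + 1), quasiSum (u.take i) xs * quasiSum (u.drop i) ys := by
  induction xs generalizing u with
  | nil =>
    cases u with
    | nil => simp
    | cons a u => rw [Finset.sum_range_succ']; simp
  | cons x xs ih =>
    cases u with
    | nil => simp
    | cons a u =>
      have h := ih (a :: u)
      rw [List.length_cons, Finset.sum_range_succ'] at h ⊢
      simp only [List.take_succ_cons, List.drop_succ_cons, List.take_zero, List.drop_zero,
        quasiSum_nil, List.cons_append, quasiSum_cons_cons] at h ⊢
      rw [h, ih, Finset.mul_sum, ← add_assoc, ← Finset.sum_add_distrib]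
      congr 1
      exact Finset.sum_congr rfl fun i _ => by ring

/-- Strict sums use `x` at most once; a plus sign after `a` supplies, through `x^(a+b) = x^a x^b`,
the terms in which `x` is used again. Commas and pluses together therefore obey the recursion of the
star sum. -/
theorem sum_commaPlus_cons_cons (a : ℕ+) (u : List ℕ+) (x : R) (xs : List R) :
    ((commaPlus (a :: u)).map fun l => quasiSum l (x :: xs)).sum =
      x ^ (a : ℕ) * ((commaPlus u).map fun l => quasiSum l (x :: xs)).sum +
        ((commaPlus (a :: u)).map fun l => quasiSum l xs).sum := by
  induction u generalizing a with
  | nil => simp [commaPlus, quasiSum_cons_cons]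
  | cons b u ih =>
    have h1 := ih (a + b)
    have h2 := ih b
    rw [commaPlus]
    simp only [List.map_append, List.map_map, List.sum_append, Function.comp_def,
      quasiSum_cons_cons, List.sum_map_add, List.sum_map_mul_left]
    rw [h1, h2, PNat.add_coe, pow_add]
    ring

/-- The star sum is the sum over all ways to replace commas by plus signs. -/
theorem sum_commaPlus (u : List ℕ+) (xs : List R) :
    ((commaPlus u).map fun l => quasiSum l xs).sum = quasiSumStar u xs := by
  induction xs generalizing u with
  | nil =>
    rcases u with _ | ⟨a, u⟩
    · simp [commaPlus]
    · rw [quasiSumStar_cons_nil]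
      induction u generalizing a with
      | nil => simp [commaPlus]
      | cons b u ih =>
        rw [commaPlus]
        simp [Function.comp_def, ih]
  | cons x xs ih =>
    induction u with
    | nil => simp [commaPlus]
    | cons a u ihu => rw [sum_commaPlus_cons_cons, ihu, ih, quasiSumStar_cons_cons]

/-- With `E(T) = ∏ (1 + y^k T)`, dividing by the factor `1 + x^k T` removes the variable `x`; this
is the coefficient form of that division, multiplied by `x^k`. -/
theorem sum_neg_pow_mul_quasiSum_replicate (k : ℕ+) (x : R) (xs : List R) (n : ℕ) :
    ∑ j ∈ Finset.range (n + 1),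
        (-1) ^ j * (x ^ (k : ℕ)) ^ (j + 1) * quasiSum (List.replicate (n - j) k) (x :: xs) =
      x ^ (k : ℕ) * quasiSum (List.replicate n k) xs := by
  induction n with
  | zero => simp
  | succ n ih =>
    rw [Finset.sum_range_succ']
    have : ∀ j, (-1 : R) ^ (j + 1) * (x ^ (k : ℕ)) ^ (j + 1 + 1) *
        quasiSum (List.replicate (n + 1 - (j + 1)) k) (x :: xs) =
        -x ^ (k : ℕ) * ((-1) ^ j * (x ^ (k : ℕ)) ^ (j + 1) *
          quasiSum (List.replicate (n - j) k) (x :: xs)) := fun j => by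
      rw [Nat.add_sub_add_right]; ring
    simp only [this, ← Finset.mul_sum, ih]
    simp only [Nat.sub_zero, List.replicate_succ, quasiSum_cons_cons]
    ring

/-- Newton's identities. -/
theorem newton_quasiSum (k : ℕ+) (xs : List R) (n : ℕ) :
    ((n + 1 : ℕ) : R) * quasiSum (List.replicate (n + 1) k) xs =
      ∑ j ∈ Finset.range (n + 1),
        (-1) ^ j * quasiSum [j.succPNat * k] xs * quasiSum (List.replicate (n - j) k) xs := by
  induction xs generalizing n with
  | nil => simp [List.replicate_succ]
  | cons x xs ih =>
    have hp : ∀ j : ℕ, quasiSum [j.succPNat * k] (x :: xs) =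
        (x ^ (k : ℕ)) ^ (j + 1) + quasiSum [j.succPNat * k] xs := fun j => by
      rw [quasiSum_cons_cons, quasiSum_nil, mul_one, ← pow_mul, PNat.mul_coe, Nat.succPNat_coe,
        mul_comm (k : ℕ)]
    simp only [hp, mul_add, add_mul, Finset.sum_add_distrib, sum_neg_pow_mul_quasiSum_replicate]
    -- Expanding `e_{n-j}(x, xs) = x^k e_{n-j-1}(xs) + e_{n-j}(xs)` leaves two Newton sums in `xs`
    -- alone, of degrees `n` and `n + 1`.
    have key : ∑ j ∈ Finset.range (n + 1), (-1) ^ j * quasiSum [j.succPNat * k] xs *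
          quasiSum (List.replicate (n - j) k) (x :: xs) =
        (n : R) * (x ^ (k : ℕ) * quasiSum (List.replicate n k) xs) +
          ((n + 1 : ℕ) : R) * quasiSum (List.replicate (n + 1) k) xs := by
      rw [ih]
      cases n with
      | zero => simp
      | succ n =>
        rw [mul_left_comm, ih, Finset.sum_range_succ, Finset.sum_range_succ _ (n + 1),
          ← add_assoc, Finset.mul_sum, ← Finset.sum_add_distrib]
        congr 1
        · refine Finset.sum_congr rfl fun j hj => ?_
          have hj : n + 1 - j = (n - j) + 1 := by
            have := Finset.mem_range.mp hj; omega
          rw [hj, List.replicate_succ, quasiSum_cons_cons]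
          ring
        · simp
    rw [key, List.replicate_succ, quasiSum_cons_cons, ← List.replicate_succ]
    push_cast
    ring

-- This is `E(-T) H(T) = 1`: adjoining a variable `x` multiplies `E(-T)` by `1 - x^k T` and divides
-- `H(T)` by it.
open PowerSeries in
theorem mk_quasiSum_mul_mk_quasiSumStar (k : ℕ+) (xs : List R) :
    (mk fun i => (-1) ^ i * quasiSum (List.replicate i k) xs) *
      (mk fun i => quasiSumStar (List.replicate i k) xs) = 1 := by
  induction xs with
  | nil =>
    have h1 : (mk fun i => (-1) ^ i * quasiSum (List.replicate i k) ([] : List R)) = 1 := by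
      ext i
      cases i <;> simp [List.replicate_succ, coeff_one]
    have h2 : (mk fun i => quasiSumStar (List.replicate i k) ([] : List R)) = 1 := by
      ext i
      cases i <;> simp [List.replicate_succ, coeff_one]
    rw [h1, h2, one_mul]
  | cons x xs ih =>
    have h1 : (mk fun i => (-1) ^ i * quasiSum (List.replicate i k) (x :: xs)) =
        (1 - C (x ^ (k : ℕ)) * X) * (mk fun i => (-1) ^ i * quasiSum (List.replicate i k) xs) := by
      ext i
      cases i with
      | zero => simp [sub_mul, mul_assoc]
      | succ i =>
        simp only [sub_mul, mul_assoc, one_mul, map_sub, coeff_C_mul, coeff_succ_X_mul, coeff_mk,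
          List.replicate_succ, quasiSum_cons_cons]
        ring
    have h2 : (1 - C (x ^ (k : ℕ)) * X) *
        (mk fun i => quasiSumStar (List.replicate i k) (x :: xs)) =
        mk fun i => quasiSumStar (List.replicate i k) xs := by
      ext i
      cases i with
      | zero => simp [sub_mul, mul_assoc]
      | succ i =>
        simp only [sub_mul, mul_assoc, one_mul, map_sub, coeff_C_mul, coeff_succ_X_mul, coeff_mk,
          List.replicate_succ, quasiSumStar_cons_cons]
        ring
    rw [h1, mul_right_comm, h2, mul_comm, ih]

theorem sum_quasiSum_mul_quasiSumStar (k : ℕ+) (xs : List R) (n : ℕ) :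
    ∑ i ∈ Finset.range (n + 2), (-1) ^ i * quasiSum (List.replicate i k) xs *
      quasiSumStar (List.replicate (n + 1 - i) k) xs = 0 := by
  have h := congrArg (PowerSeries.coeff (n + 1)) (mk_quasiSum_mul_mk_quasiSumStar k xs)
  rw [PowerSeries.coeff_mul, Finset.Nat.sum_antidiagonal_eq_sum_range_succ_mk] at h
  simpa [PowerSeries.coeff_one] using h

end QuasiSum

/-! ### Newton's identities for power sums whose triple products vanish -/

section Nilpotent

variable {R : Type*} [CommRing R]

/-- The reflection `j ↦ n - 1 - j` fixes the product of the two `q`'s and exchanges the weights `j +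
1` and `n - j`, whose sum is `n + 1`. -/
theorem two_mul_sum_succ_mul (q : ℕ → R) (n : ℕ) :
    2 * ∑ j ∈ Finset.range n, ((j + 1 : ℕ) : R) * (q (j + 1) * q (n - j)) =
      ((n + 1 : ℕ) : R) * ∑ j ∈ Finset.range n, q (j + 1) * q (n - j) := by
  have h := Finset.sum_range_reflect
    (fun j => ((j + 1 : ℕ) : R) * (q (j + 1) * q (n - j))) n
  rw [two_mul]
  nth_rewrite 1 [← h]
  rw [← Finset.sum_add_distrib, Finset.mul_sum]
  refine Finset.sum_congr rfl fun j hj => ?_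
  have hj := Finset.mem_range.mp hj
  have h1 : n - 1 - j + 1 = n - j := by omega
  have h2 : n - (n - 1 - j) = j + 1 := by omega
  have h3 : ((n + 1 : ℕ) : R) = ((n - j : ℕ) : R) + ((j + 1 : ℕ) : R) := by
    rw [← Nat.cast_add]; congr 1; omega
  rw [h1, h2, h3]
  ring

variable [Algebra ℚ R]

theorem eq_of_natCast_succ_mul_eq {a b : R} (n : ℕ)
    (h : ((n + 1 : ℕ) : R) * a = ((n + 1 : ℕ) : R) * b) : a = b := by
  have hu : IsUnit (((n + 1 : ℕ) : R)) := by
    have : IsUnit (((n + 1 : ℕ) : ℚ)) := isUnit_iff_ne_zero.mpr (by positivity)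
    simpa using this.map (algebraMap ℚ R)
  exact hu.mul_left_cancel h

variable {e h q : ℕ → R}

/-- The expansion of `exp(∑ (-1)^{j-1} q_j T^j)` through quadratic terms. The second conclusion is
also needed for the complete symmetric functions. -/
theorem elementary_eq_of_newton (e0 : e 0 = 1)
    (newton : ∀ n, ((n + 1 : ℕ) : R) * e (n + 1) =
      ∑ j ∈ Finset.range (n + 1), (-1) ^ j * (((j + 1 : ℕ) : R) * q (j + 1)) * e (n - j))
    (hq : ∀ i j l, q (i + 1) * q (j + 1) * q (l + 1) = 0) (n : ℕ) :
    2 * e (n + 1) = (-1) ^ n * (2 * q (n + 1) - ∑ j ∈ Finset.range n, q (j + 1) * q (n - j)) ∧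
      ∀ i j, e (n + 1) * (q (i + 1) * q (j + 1)) = 0 := by
  -- Each term of Newton's formula already contains one `q`, so two further factors kill it.
  have hA : ∀ n i j, e (n + 1) * (q (i + 1) * q (j + 1)) = 0 := fun n i j => by
    refine eq_of_natCast_succ_mul_eq n ?_
    rw [← mul_assoc, newton, mul_zero, Finset.sum_mul]
    refine Finset.sum_eq_zero fun l _ => ?_
    linear_combination (-1) ^ l * ((l + 1 : ℕ) : R) * e (n - l) * hq l i j
  -- Against a single `q` only the linear part of `e (n + 1)` survives: the summand containing `e
  -- 0`.
  have hB : ∀ n i, q (i + 1) * e (n + 1) = (-1) ^ n * (q (i + 1) * q (n + 1)) := fun n i => by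
    refine eq_of_natCast_succ_mul_eq n ?_
    rw [mul_left_comm, newton, Finset.mul_sum, Finset.sum_range_succ, Finset.sum_eq_zero]
    · rw [Nat.sub_self, e0]; ring
    · intro l hl
      obtain ⟨m, hm⟩ : ∃ m, n - l = m + 1 :=
        ⟨n - l - 1, by have := Finset.mem_range.mp hl; omega⟩
      rw [hm]
      linear_combination (-1) ^ l * ((l + 1 : ℕ) : R) * hA m i l
  refine ⟨eq_of_natCast_succ_mul_eq n ?_, hA n⟩
  rw [mul_left_comm, newton, Finset.sum_range_succ, Nat.sub_self, e0]
  have : ∑ j ∈ Finset.range n, (-1) ^ j * (((j + 1 : ℕ) : R) * q (j + 1)) * e (n - j) =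
      -(-1) ^ n * ∑ j ∈ Finset.range n, ((j + 1 : ℕ) : R) * (q (j + 1) * q (n - j)) := by
    rw [Finset.mul_sum]
    refine Finset.sum_congr rfl fun j hj => ?_
    obtain ⟨m, hm⟩ : ∃ m, n = j + m + 1 :=
      ⟨n - j - 1, by have := Finset.mem_range.mp hj; omega⟩
    have hm' : n - j = m + 1 := by omega
    rw [hm', hm]
    linear_combination (-1) ^ j * ((j + 1 : ℕ) : R) * hB m j
  rw [this]
  linear_combination -(-1) ^ n * two_mul_sum_succ_mul q n

/-- The same truncation for `H(T) = 1 / E(-T) = exp(∑ q_j T^j)`: inverting changes the sign of the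
quadratic correction relative to the linear term. -/
theorem complete_eq_of_newton (e0 : e 0 = 1) (h0 : h 0 = 1)
    (newton : ∀ n, ((n + 1 : ℕ) : R) * e (n + 1) =
      ∑ j ∈ Finset.range (n + 1), (-1) ^ j * (((j + 1 : ℕ) : R) * q (j + 1)) * e (n - j))
    (eh : ∀ n, ∑ i ∈ Finset.range (n + 2), (-1) ^ i * e i * h (n + 1 - i) = 0)
    (hq : ∀ i j l, q (i + 1) * q (j + 1) * q (l + 1) = 0) (n : ℕ) :
    2 * h (n + 1) = 2 * q (n + 1) + ∑ j ∈ Finset.range n, q (j + 1) * q (n - j) := by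
  have he := elementary_eq_of_newton e0 newton hq
  have hrec : ∀ n, h (n + 1) = ∑ i ∈ Finset.range (n + 1), (-1) ^ i * e (i + 1) * h (n - i) :=
    fun n => by
      have := eh n
      rw [Finset.sum_range_succ'] at this
      simp only [Nat.add_sub_add_right, pow_zero, e0, Nat.sub_zero, one_mul] at this
      rw [← sub_eq_zero, ← this, sub_eq_add_neg, add_comm, ← Finset.sum_neg_distrib]
      congr 1
      exact Finset.sum_congr rfl fun i _ => by ring
  have hA : ∀ n i j, h (n + 1) * (q (i + 1) * q (j + 1)) = 0 := fun n i j => by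
    rw [hrec, Finset.sum_mul]
    refine Finset.sum_eq_zero fun l _ => ?_
    linear_combination (-1) ^ l * h (n - l) * (he l).2 i j
  have two_cancel : ∀ a b : R, 2 * a = 2 * b → a = b := fun a b hab =>
    eq_of_natCast_succ_mul_eq 1 (by simpa [one_add_one_eq_two] using hab)
  have hss : ∀ n m, h (m + 1) * ∑ j ∈ Finset.range n, q (j + 1) * q (n - j) = 0 := fun n m => by
    rw [Finset.mul_sum]
    refine Finset.sum_eq_zero fun j hj => ?_
    obtain ⟨l, hl⟩ : ∃ l, n - j = l + 1 :=
      ⟨n - j - 1, by have := Finset.mem_range.mp hj; omega⟩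
    rw [hl, hA]
  -- A factor `h (m + 1)` counts as one `q`, so it annihilates the quadratic part of `e (i + 1)`.
  have heh : ∀ i m, (-1) ^ i * e (i + 1) * h (m + 1) = q (i + 1) * h (m + 1) := fun i m => by
    apply two_cancel
    have h1 : ((-1 : R) ^ i) * (-1) ^ i = 1 := by rw [← mul_pow]; simp
    linear_combination (-1) ^ i * h (m + 1) * (he i).1 - (-1) ^ i * (-1) ^ i * hss i m +
      2 * q (i + 1) * h (m + 1) * h1
  have hqh : ∀ m i, q (i + 1) * h (m + 1) = q (i + 1) * q (m + 1) := fun m i => by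
    rw [hrec, Finset.mul_sum, Finset.sum_range_succ, Finset.sum_eq_zero]
    · apply two_cancel
      have h1 : ((-1 : R) ^ m) * (-1) ^ m = 1 := by rw [← mul_pow]; simp
      have h2 : q (i + 1) * ∑ j ∈ Finset.range m, q (j + 1) * q (m - j) = 0 := by
        rw [Finset.mul_sum]
        refine Finset.sum_eq_zero fun j hj => ?_
        obtain ⟨l, hl⟩ : ∃ l, m - j = l + 1 :=
          ⟨m - j - 1, by have := Finset.mem_range.mp hj; omega⟩
        rw [hl, ← mul_assoc, hq]
      rw [Nat.sub_self, h0]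
      linear_combination q (i + 1) * (-1) ^ m * (he m).1 - (-1) ^ m * (-1) ^ m * h2 +
        2 * q (i + 1) * q (m + 1) * h1
    · intro l hl
      obtain ⟨s, hs⟩ : ∃ s, m - l = s + 1 :=
        ⟨m - l - 1, by have := Finset.mem_range.mp hl; omega⟩
      rw [hs, heh]
      linear_combination hA s i l
  rw [hrec, Finset.sum_range_succ, Nat.sub_self, h0]
  have h1 : ((-1 : R) ^ n) * (-1) ^ n = 1 := by rw [← mul_pow]; simp
  have h2 : ∑ i ∈ Finset.range n, (-1) ^ i * e (i + 1) * h (n - i) =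
      ∑ j ∈ Finset.range n, q (j + 1) * q (n - j) := by
    refine Finset.sum_congr rfl fun j hj => ?_
    obtain ⟨l, hl⟩ : ∃ l, n - j = l + 1 :=
      ⟨n - j - 1, by have := Finset.mem_range.mp hj; omega⟩
    rw [hl, heh, hqh]
  rw [h2]
  linear_combination (-1) ^ n * (he n).1 +
    (2 * q (n + 1) - ∑ j ∈ Finset.range n, q (j + 1) * q (n - j)) * h1

end Nilpotent

/-! ### Sums over monotone families of integers -/

section MonotoneSums

variable {R : Type*} [CommRing R]

theorem monotone_cons_iff {n : ℕ} {a : ℕ} {m : Fin n → ℕ} :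
    Monotone (Fin.cons a m : Fin (n + 1) → ℕ) ↔ (∀ i, a ≤ m i) ∧ Monotone m := by
  refine ⟨fun h => ⟨fun i => ?_, fun i j hij => ?_⟩, fun ⟨h1, h2⟩ i j => ?_⟩
  · simpa using h (Fin.zero_le i.succ)
  · simpa using h (Fin.succ_le_succ_iff.mpr hij)
  · refine Fin.cases ?_ (fun i => ?_) i <;> refine Fin.cases ?_ (fun j => ?_) j
    · simp
    · simpa using h1 j
    · simp
    · simpa using fun hij => h2 hij

-- Splitting by whether the smallest entry equals the left endpoint `s` reproduces the recursion of
-- `quasiSum`; in the first case strictness moves the remaining entries to start at `s + 1`.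
open scoped Classical in
theorem sum_strictMono_eq_quasiSum (f : ℕ → R) (k : List ℕ+) (s n : ℕ) :
    ∑ m ∈ (Fintype.piFinset fun _ : Fin k.length => Finset.Ico s (s + n)) with StrictMono m,
        ∏ i, f (m i) ^ (k.get i : ℕ) =
      quasiSum k ((List.range' s n).map f) := by
  induction n generalizing s k with
  | zero =>
    cases k with
    | nil => simp [Subsingleton.strictMono]
    | cons a u =>
      rw [Finset.sum_eq_zero]
      · simp
      · intro m hm
        have := Fintype.mem_piFinset.mp (Finset.mem_filter.mp hm).1 ⟨0, by simp⟩
        simp at this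
  | succ n ih =>
    cases k with
    | nil => simp [Subsingleton.strictMono]
    | cons a u =>
      rw [List.range'_succ, List.map_cons, quasiSum_cons_cons, ← ih, ← ih,
        ← Finset.sum_filter_add_sum_filter_not _ (fun m => m ⟨0, by simp⟩ = s)]
      congr 1
      · rw [Finset.mul_sum]
        refine Finset.sum_nbij' (fun m => Fin.tail (n := u.length) m)
          (fun m => Fin.cons (n := u.length) s m) ?_ ?_ ?_ ?_ ?_
        · intro m hm
          obtain ⟨⟨hm, hmono⟩, h0⟩ := by simpa only [Finset.mem_filter] using hm
          change Fin (u.length + 1) → ℕ at m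
          rw [← Fin.cons_self_tail m, Fin.strictMono_cons] at hmono
          simp only [Finset.mem_filter, Fintype.mem_piFinset, Finset.mem_Ico] at hm ⊢
          refine ⟨fun i => ?_, hmono.2⟩
          have h1 := hmono.1 i
          have h2 := hm i.succ
          change m 0 = s at h0
          rw [h0] at h1
          simp only [Fin.tail] at h1 ⊢
          exact ⟨h1, by omega⟩
        · intro m hm
          simp only [Finset.mem_filter, Fintype.mem_piFinset, Finset.mem_Ico] at hm ⊢
          refine ⟨⟨?_, Fin.strictMono_cons.mpr ⟨fun i => (hm.1 i).1, hm.2⟩⟩, rfl⟩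
          refine Fin.cases ?_ fun i => ?_
          · simp
          · have := hm.1 i
            simp only [Fin.cons_succ]
            omega
        · intro m hm
          have h0 := (Finset.mem_filter.mp hm).2
          change Fin (u.length + 1) → ℕ at m
          change m 0 = s at h0
          rw [← h0]
          exact Fin.cons_self_tail m
        · intro m _
          exact Fin.tail_cons _ _
        · intro m hm
          have h0 := (Finset.mem_filter.mp hm).2
          change Fin (u.length + 1) → ℕ at m
          change m 0 = s at h0
          subst h0
          exact Fin.prod_univ_succ (fun i : Fin (u.length + 1) => f (m i) ^ ((a :: u).get i : ℕ))
      · rw [Finset.filter_filter]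
        refine Finset.sum_congr (Finset.ext fun m => ?_) fun _ _ => rfl
        simp only [Finset.mem_filter, Fintype.mem_piFinset, Finset.mem_Ico]
        have hl : 0 < (a :: u).length := by simp
        constructor
        · rintro ⟨h1, h2, h3⟩
          refine ⟨fun i => ?_, h2⟩
          have h4 := h2.monotone (show (⟨0, hl⟩ : Fin (a :: u).length) ≤ i from Nat.zero_le _)
          have h5 := h1 i
          have h6 := h1 ⟨0, hl⟩
          omega
        · rintro ⟨h1, h2⟩
          have h6 := h1 ⟨0, hl⟩
          refine ⟨fun i => ?_, h2, by omega⟩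
          have := h1 i
          omega

-- Here the remaining entries may equal `s` again, so the interval is not shortened when the first
-- entry is removed. This forces an inner induction on the index.
open scoped Classical in
theorem sum_monotone_eq_quasiSumStar (f : ℕ → R) (k : List ℕ+) (s n : ℕ) :
    ∑ m ∈ (Fintype.piFinset fun _ : Fin k.length => Finset.Ico s (s + n)) with Monotone m,
        ∏ i, f (m i) ^ (k.get i : ℕ) =
      quasiSumStar k ((List.range' s n).map f) := by
  induction n generalizing s k with
  | zero =>
    cases k with
    | nil => simp [Subsingleton.monotone]
    | cons a u =>
      rw [Finset.sum_eq_zero]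
      · simp
      · intro m hm
        have := Fintype.mem_piFinset.mp (Finset.mem_filter.mp hm).1 ⟨0, by simp⟩
        simp at this
  | succ n ihn =>
    induction k with
    | nil => simp [Subsingleton.monotone]
    | cons a u ih =>
      rw [List.range'_succ, List.map_cons, quasiSumStar_cons_cons, ← List.map_cons,
        ← List.range'_succ, ← ih, ← ihn,
        ← Finset.sum_filter_add_sum_filter_not _ (fun m => m ⟨0, by simp⟩ = s)]
      congr 1
      · rw [Finset.mul_sum]
        refine Finset.sum_nbij' (fun m => Fin.tail (n := u.length) m)
          (fun m => Fin.cons (n := u.length) s m) ?_ ?_ ?_ ?_ ?_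
        · intro m hm
          obtain ⟨⟨hm, hmono⟩, h0⟩ := by simpa only [Finset.mem_filter] using hm
          change Fin (u.length + 1) → ℕ at m
          rw [← Fin.cons_self_tail m, monotone_cons_iff] at hmono
          simp only [Finset.mem_filter, Fintype.mem_piFinset, Finset.mem_Ico] at hm ⊢
          exact ⟨fun i => hm i.succ, hmono.2⟩
        · intro m hm
          simp only [Finset.mem_filter, Fintype.mem_piFinset, Finset.mem_Ico] at hm ⊢
          refine ⟨⟨?_, monotone_cons_iff.mpr ⟨fun i => (hm.1 i).1, hm.2⟩⟩, rfl⟩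
          refine Fin.cases ?_ fun i => ?_
          · simp
          · simpa only [Fin.cons_succ] using hm.1 i
        · intro m hm
          have h0 := (Finset.mem_filter.mp hm).2
          change Fin (u.length + 1) → ℕ at m
          change m 0 = s at h0
          rw [← h0]
          exact Fin.cons_self_tail m
        · intro m _
          exact Fin.tail_cons _ _
        · intro m hm
          have h0 := (Finset.mem_filter.mp hm).2
          change Fin (u.length + 1) → ℕ at m
          change m 0 = s at h0
          subst h0
          exact Fin.prod_univ_succ (fun i : Fin (u.length + 1) => f (m i) ^ ((a :: u).get i : ℕ))
      · rw [Finset.filter_filter]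
        refine Finset.sum_congr (Finset.ext fun m => ?_) fun _ _ => rfl
        simp only [Finset.mem_filter, Fintype.mem_piFinset, Finset.mem_Ico]
        have hl : 0 < (a :: u).length := by simp
        constructor
        · rintro ⟨h1, h2, h3⟩
          refine ⟨fun i => ?_, h2⟩
          have h4 := h2 (show (⟨0, hl⟩ : Fin (a :: u).length) ≤ i from Nat.zero_le _)
          have h5 := h1 i
          have h6 := h1 ⟨0, hl⟩
          omega
        · rintro ⟨h1, h2⟩
          have h6 := h1 ⟨0, hl⟩
          refine ⟨fun i => ?_, h2, by omega⟩
          have := h1 i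
          omega

end MonotoneSums

/-! ### Closed forms from Newton's identities when `x² = 0` or `x³ = 0`. -/

theorem sum_Icc_one_eq_sum_range {R : Type*} [AddCommMonoid R] (f : ℕ → R) (n : ℕ) :
    ∑ l ∈ Finset.Icc 1 n, f l = ∑ j ∈ Finset.range n, f (j + 1) := by
  rw [← Finset.Ico_add_one_right_eq_Icc, Finset.sum_Ico_eq_sum_range]
  exact Finset.sum_congr (by simp) fun j _ => by rw [add_comm]

section ClosedForms

variable {R : Type*} [CommRing R] [Algebra ℚ R]

theorem two_mul_cancel {a b : R} (h : 2 * a = 2 * b) : a = b :=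
  eq_of_natCast_succ_mul_eq 1 (by simpa [one_add_one_eq_two] using h)

theorem closed_form_of_sq_eq_zero {e h P D : ℕ → R} {x : R} (k : ℕ) (hx : x ^ 2 = 0)
    (e0 : e 0 = 1) (h0 : h 0 = 1)
    (newton : ∀ n, ((n + 1 : ℕ) : R) * e (n + 1) =
      ∑ j ∈ Finset.range (n + 1), (-1) ^ j * P (j + 1) * e (n - j))
    (eh : ∀ n, ∑ i ∈ Finset.range (n + 2), (-1) ^ i * e i * h (n + 1 - i) = 0)
    (hP : ∀ j, P (j + 1) = (((j + 1) * k : ℕ) : R) * (D ((j + 1) * k + 1) * x))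
    (r : ℕ) (hr : 0 < r) :
    e r = ((-1) ^ (r - 1) * (k : ℚ)) • (D (r * k + 1) * x) ∧
      h r = (k : ℚ) • (D (r * k + 1) * x) := by
  obtain ⟨n, rfl⟩ : ∃ n, r = n + 1 := ⟨r - 1, by omega⟩
  let q : ℕ → R := fun j => k * (D (j * k + 1) * x)
  have newton' : ∀ n, ((n + 1 : ℕ) : R) * e (n + 1) =
      ∑ j ∈ Finset.range (n + 1), (-1) ^ j * (((j + 1 : ℕ) : R) * q (j + 1)) * e (n - j) :=
    fun n => by
      rw [newton]
      refine Finset.sum_congr rfl fun j _ => ?_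
      rw [hP]
      push_cast [q]
      ring
  have hqq : ∀ i j, q i * q j = 0 := fun i j => by
    linear_combination (k : R) ^ 2 * D (i * k + 1) * D (j * k + 1) * hx
  have hqqq : ∀ i j l, q (i + 1) * q (j + 1) * q (l + 1) = 0 := fun i j l => by
    rw [hqq, zero_mul]
  have h1 := (elementary_eq_of_newton e0 newton' hqqq n).1
  have h2 := complete_eq_of_newton e0 h0 newton' eh hqqq n
  simp only [hqq, Finset.sum_const_zero, sub_zero, add_zero] at h1 h2
  refine ⟨two_mul_cancel ?_, two_mul_cancel ?_⟩
  · rw [h1, Algebra.smul_def]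
    simp only [q, map_mul, map_pow, map_neg, map_one, map_natCast, Nat.add_sub_cancel]
    ring
  · rw [h2, Algebra.smul_def, map_natCast]

/-- All that the cases `𝒜` and `𝒮` share: `P` stands for the power sums, `D` for the depth-one
values, and `hP` is the only arithmetic input. -/
theorem closed_form_of_cube_eq_zero {e h P D : ℕ → R} {x : R} (k : ℕ) (hx : x ^ 3 = 0)
    (e0 : e 0 = 1) (h0 : h 0 = 1)
    (newton : ∀ n, ((n + 1 : ℕ) : R) * e (n + 1) =
      ∑ j ∈ Finset.range (n + 1), (-1) ^ j * P (j + 1) * e (n - j))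
    (eh : ∀ n, ∑ i ∈ Finset.range (n + 2), (-1) ^ i * e i * h (n + 1 - i) = 0)
    (hP : ∀ j, 2 * P (j + 1) = (-1) ^ ((j + 1) * k) * (2 * (((j + 1) * k : ℕ) : R) *
      (D ((j + 1) * k + 1) * x) + (((j + 1) * k : ℕ) : R) * (((j + 1) * k + 1 : ℕ) : R) *
        (D ((j + 1) * k + 2) * x ^ 2)))
    (r : ℕ) (hr : 0 < r) :
    e r = ((-1) ^ (r * k + r - 1) : ℚ) •
          ((k : ℚ) • (D (r * k + 1) * x) +
            (((k : ℚ) * (r * k + 1) / 2) • D (r * k + 2) -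
              ((k : ℚ) ^ 2 / 2) • ∑ l ∈ Finset.Icc 1 (r - 1),
                D (l * k + 1) * D ((r - l) * k + 1)) * x ^ 2) ∧
      h r = ((-1) ^ (r * k) : ℚ) •
          ((k : ℚ) • (D (r * k + 1) * x) +
            (((k : ℚ) * (r * k + 1) / 2) • D (r * k + 2) +
              ((k : ℚ) ^ 2 / 2) • ∑ l ∈ Finset.Icc 1 (r - 1),
                D (l * k + 1) * D ((r - l) * k + 1)) * x ^ 2) := by
  obtain ⟨n, rfl⟩ : ∃ n, r = n + 1 := ⟨r - 1, by omega⟩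
  obtain ⟨c, hc⟩ : ∃ c : R, algebraMap ℚ R 2⁻¹ = c := ⟨_, rfl⟩
  have h2c : 2 * c = 1 := by
    rw [← hc, ← map_ofNat (algebraMap ℚ R) 2, ← map_mul]
    norm_num
  let q : ℕ → R := fun j => (-1) ^ (j * k) * (k * (D (j * k + 1) * x) +
    c * (k * (j * k + 1) * (D (j * k + 2) * x ^ 2)))
  have newton' : ∀ n, ((n + 1 : ℕ) : R) * e (n + 1) =
      ∑ j ∈ Finset.range (n + 1), (-1) ^ j * (((j + 1 : ℕ) : R) * q (j + 1)) * e (n - j) :=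
    fun n => by
      rw [newton]
      refine Finset.sum_congr rfl fun j _ => ?_
      congr 2
      apply two_mul_cancel
      rw [hP]
      push_cast [q]
      linear_combination -(-1) ^ ((j + 1) * k) * ((j : R) + 1) * (k * ((j + 1) * k + 1) *
        (D ((j + 1) * k + 2) * x ^ 2)) * h2c
  -- Only the linear parts contribute modulo `x³`. The sign depends on `i + j` alone, so it comes
  -- out of the convolution as `(-1)^{rk}`.
  have hqq : ∀ i j, q i * q j =
      (-1) ^ ((i + j) * k) * (k ^ 2 * (D (i * k + 1) * D (j * k + 1)) * x ^ 2) := fun i j => by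
    simp only [q, add_mul, pow_add]
    linear_combination (-1) ^ (i * k) * (-1) ^ (j * k) * (k * D (i * k + 1) *
      (c * (k * (j * k + 1) * D (j * k + 2))) + k * D (j * k + 1) *
      (c * (k * (i * k + 1) * D (i * k + 2))) + c * (k * (j * k + 1) * D (j * k + 2)) *
      (c * (k * (i * k + 1) * D (i * k + 2))) * x) * hx
  have hqqq : ∀ i j l, q (i + 1) * q (j + 1) * q (l + 1) = 0 := fun i j l => by
    rw [hqq]
    simp only [q]
    linear_combination (-1) ^ ((i + 1 + (j + 1)) * k) * (k ^ 2 *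
      (D ((i + 1) * k + 1) * D ((j + 1) * k + 1))) * ((-1) ^ ((l + 1) * k) *
      (k * (D ((l + 1) * k + 1)) +
        c * (k * (((l + 1 : ℕ) : R) * k + 1) * (D ((l + 1) * k + 2) * x)))) * hx
  have h1 := (elementary_eq_of_newton e0 newton' hqqq n).1
  have h2 := complete_eq_of_newton e0 h0 newton' eh hqqq n
  have hs : ∑ j ∈ Finset.range n, q (j + 1) * q (n - j) = (-1) ^ ((n + 1) * k) *
      (k ^ 2 * (∑ l ∈ Finset.Icc 1 n, D (l * k + 1) * D ((n + 1 - l) * k + 1)) * x ^ 2) := by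
    rw [sum_Icc_one_eq_sum_range, Finset.mul_sum, Finset.sum_mul, Finset.mul_sum]
    refine Finset.sum_congr rfl fun j hj => ?_
    have hj : j + 1 + (n - j) = n + 1 := by have := Finset.mem_range.mp hj; omega
    rw [hqq, hj, Nat.add_sub_add_right]
  rw [hs] at h1 h2
  have hexp : (n + 1) * k + (n + 1) - 1 = (n + 1) * k + n := by omega
  simp only [hexp, Nat.add_sub_cancel, Algebra.smul_def, div_eq_mul_inv, map_mul, map_pow, map_neg,
    map_one, map_natCast, map_add, hc, pow_add (-1 : R) ((n + 1) * k) n]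
  refine ⟨two_mul_cancel ?_, two_mul_cancel ?_⟩
  · rw [h1]
    simp only [q]
    push_cast
    linear_combination (-1) ^ n * (-1) ^ ((n + 1) * k) *
      (k ^ 2 * (∑ l ∈ Finset.Icc 1 n, D (l * k + 1) * D ((n + 1 - l) * k + 1)) * x ^ 2) * h2c
  · rw [h2]
    simp only [q]
    push_cast
    linear_combination -(-1) ^ ((n + 1) * k) *
      (k ^ 2 * (∑ l ∈ Finset.Icc 1 n, D (l * k + 1) * D ((n + 1 - l) * k + 1)) * x ^ 2) * h2c

end ClosedForms

/-! ### Rational numbers that are integral at `p` -/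

section PIntegral

variable (p : ℕ) [Fact p.Prime]

/-- The ring of rational numbers that are integral at `p`. -/
def pIntegers : Subring ℚ := (PadicInt.subring p).comap (Rat.castHom ℚ_[p])

theorem mem_pIntegers {q : ℚ} : q ∈ pIntegers p ↔ ‖(q : ℚ_[p])‖ ≤ 1 := Iff.rfl

/-- Reduction modulo `pⁿ` of the rational numbers that are integral at `p`. -/
def pIntegersMod (n : ℕ) : pIntegers p →+* ZMod (p ^ n) :=
  (PadicInt.toZModPow n).comp
    ((Rat.castHom ℚ_[p]).restrict (pIntegers p) (PadicInt.subring p) fun _ h => h)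

theorem ratMod_eq_pIntegersMod (n : ℕ) (q : pIntegers p) :
    ratMod (p ^ n) q = pIntegersMod p n q := by
  have hden : IsUnit (((q : ℚ).den : ℕ) : ZMod (p ^ n)) := by
    simpa using (PadicInt.isUnit_den (q : ℚ) q.2).map (PadicInt.toZModPow (p := p) n)
  have h : q * ((q : ℚ).den : pIntegers p) = ((q : ℚ).num : pIntegers p) :=
    Subtype.ext (by simp)
  have h2 := congrArg (pIntegersMod p n) h
  rw [map_mul, map_natCast, map_intCast] at h2
  rw [ratMod, ← h2, mul_assoc, ZMod.mul_inv_of_unit _ hden, mul_one]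

variable {p}

theorem inv_natCast_mem_pIntegers {m : ℕ} (hm : ¬ p ∣ m) : (m : ℚ)⁻¹ ∈ pIntegers p := by
  rw [mem_pIntegers]
  have h : ‖((m : ℕ) : ℚ_[p])‖ = 1 := by
    rw [Padic.norm_natCast_eq_one_iff]
    exact (Nat.Prime.coprime_iff_not_dvd Fact.out).mpr hm
  push_cast
  rw [norm_inv, h, inv_one]

/-- If `p^v` divides `m` exactly, then `p^v ≤ m < p^(i+1)`, so `v ≤ i`. -/
theorem pow_div_mem_pIntegers {i m : ℕ} (h0 : m ≠ 0) (hm : m < p ^ (i + 1)) :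
    (p : ℚ) ^ i / m ∈ pIntegers p := by
  have hp : p.Prime := Fact.out
  obtain ⟨v, m', hm', rfl⟩ := Nat.exists_eq_pow_mul_and_not_dvd h0 p hp.ne_one
  have hv : v ≤ i := by
    by_contra hv
    have h1 : p ^ (i + 1) ≤ p ^ v := Nat.pow_le_pow_right hp.pos (by omega)
    have h2 : p ^ v ≤ p ^ v * m' :=
      Nat.le_mul_of_pos_right _ (Nat.pos_of_ne_zero fun h => hm' (h ▸ dvd_zero p))
    omega
  obtain ⟨w, rfl⟩ := Nat.exists_eq_add_of_le hv
  have hp0 : (p : ℚ) ≠ 0 := by exact_mod_cast hp.ne_zero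
  have : (p : ℚ) ^ (v + w) / ((p ^ v * m' : ℕ) : ℚ) = (p : ℚ) ^ w * (m' : ℚ)⁻¹ := by
    push_cast
    rw [pow_add]
    field_simp
  rw [this]
  exact mul_mem (pow_mem (natCast_mem _ _) _) (inv_natCast_mem_pIntegers hm')

/-- By von Staudt–Clausen, `1/p` enters the fractional part of an even-index `B_n` only if `p - 1 ∣
n`. -/
theorem bernoulli_mem_pIntegers {n : ℕ} (hn : ¬ (p - 1) ∣ n) :
    bernoulli n ∈ pIntegers p := by
  have hp : p.Prime := Fact.out
  rcases Nat.even_or_odd' n with ⟨m, rfl | rfl⟩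
  · obtain ⟨z, hz⟩ := Bernoulli.vonStaudt_clausen m
    rw [← sub_eq_iff_eq_add.mpr hz]
    refine sub_mem (intCast_mem _ z) (sum_mem fun q hq => ?_)
    obtain ⟨-, hq, hdvd⟩ := Finset.mem_filter.mp hq
    rw [one_div]
    refine inv_natCast_mem_pIntegers fun h => hn ?_
    rwa [(Nat.prime_dvd_prime_iff_eq hp hq).mp h]
  · rcases Nat.eq_zero_or_pos m with rfl | hm
    · have h2 : ¬ p ∣ 2 := fun h => hn (by
        have := Nat.le_of_dvd two_pos h
        have h2 : p = 2 := le_antisymm this hp.two_le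
        simp [h2])
      have := neg_mem (inv_natCast_mem_pIntegers h2)
      simpa [neg_div] using this
    · rw [bernoulli_eq_zero_of_odd (odd_two_mul_add_one m) (by omega)]
      exact zero_mem _

theorem mul_bernoulli_mem_pIntegers (n : ℕ) : (p : ℚ) * bernoulli n ∈ pIntegers p := by
  have hp : p.Prime := Fact.out
  rcases Nat.even_or_odd' n with ⟨m, rfl | rfl⟩
  · obtain ⟨z, hz⟩ := Bernoulli.vonStaudt_clausen m
    rw [← sub_eq_iff_eq_add.mpr hz, mul_sub, Finset.mul_sum]
    refine sub_mem (mul_mem (natCast_mem _ _) (intCast_mem _ z)) (sum_mem fun q hq => ?_)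
    obtain ⟨-, hq, hdvd⟩ := Finset.mem_filter.mp hq
    by_cases h : p = q
    · subst h
      rw [mul_one_div_cancel (by exact_mod_cast hp.ne_zero)]
      exact one_mem _
    · rw [one_div]
      exact mul_mem (natCast_mem _ _)
        (inv_natCast_mem_pIntegers fun h' => h ((Nat.prime_dvd_prime_iff_eq hp hq).mp h'))
  · rcases Nat.eq_zero_or_pos m with rfl | hm
    · have := pow_div_mem_pIntegers (p := p) (i := 1) (m := 2) two_ne_zero
        (by rw [one_add_one_eq_two]; have := Nat.pow_le_pow_left hp.two_le 2; omega)
      have := neg_mem this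
      simp only [mul_zero, zero_add, bernoulli_one]
      convert this using 1
      push_cast
      ring
    · rw [bernoulli_eq_zero_of_odd (odd_two_mul_add_one m) (by omega), mul_zero]
      exact zero_mem _

/-- Faulhaber's formula for `∑_{m < p} m ^ (N + 2)`, modulo `p³`. -/
theorem exists_sum_pow_eq (h5 : 5 ≤ p) {N : ℕ} (hN : ¬ (p - 1) ∣ N) :
    ∃ T ∈ pIntegers p, 2 * ∑ m ∈ Finset.range p, (m : ℚ) ^ (N + 2) =
      2 * p * bernoulli (N + 2) + (N + 2 : ℕ) * p ^ 2 * bernoulli (N + 1) + p ^ 3 * T := by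
  have hp0 : (p : ℚ) ≠ 0 := by positivity
  -- The identity `C(N+3, j+1) / (N+3) = C(N+2, j) / (j+1)`, with the sum reversed, puts Faulhaber's
  -- formula in increasing powers of `p` and removes the denominator `N + 3`.
  have hterm : ∀ j ∈ Finset.range (N + 2 + 1),
      bernoulli (N + 2 + 1 - 1 - j) * ((N + 2 + 1).choose (N + 2 + 1 - 1 - j)) *
        (p : ℚ) ^ (N + 2 + 1 - (N + 2 + 1 - 1 - j)) / ((N + 2 : ℕ) + 1) =
      bernoulli (N + 2 - j) * (N + 2).choose j * (p ^ (j + 1) / (j + 1 : ℕ)) := fun j hj => by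
    have hj := Finset.mem_range.mp hj
    have h1 : N + 2 + 1 - (N + 2 + 1 - 1 - j) = j + 1 := by omega
    have h2 : (N + 2 + 1).choose (N + 2 + 1 - 1 - j) = (N + 2 + 1).choose (j + 1) := by
      rw [← Nat.choose_symm (show j + 1 ≤ N + 2 + 1 by omega)]
      congr 1; omega
    have h3 : ((N + 2 : ℕ) + 1 : ℚ) * (N + 2).choose j =
        (N + 2 + 1).choose (j + 1) * (j + 1 : ℕ) := by
      exact_mod_cast Nat.add_one_mul_choose_eq (N + 2) j
    have h4 : ((j + 1 : ℕ) : ℚ) ≠ 0 := by positivity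
    have h5 : ((N + 2 : ℕ) + 1 : ℚ) ≠ 0 := by positivity
    rw [h1, h2, Nat.add_sub_cancel, mul_div_assoc', div_eq_div_iff h5 h4]
    linear_combination -bernoulli (N + 2 - j) * p ^ (j + 1) * h3
  have hsum := sum_range_pow p (N + 2)
  rw [← Finset.sum_range_reflect _ (N + 2 + 1), Finset.sum_congr rfl hterm, Finset.sum_range_succ',
    Finset.sum_range_succ', Finset.sum_range_succ'] at hsum
  -- The `p³` term needs `B_N` and `1/3` to be integral at `p`. In each later term one `p` is spent
  -- on the Bernoulli number, and `p^j / (j+4)` is integral because `j + 4 < 5^(j+1) ≤ p^(j+1)`.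
  refine ⟨2 * (∑ j ∈ Finset.range N, ((p * bernoulli (N + 2 - (j + 1 + 1 + 1))) *
    (N + 2).choose (j + 1 + 1 + 1)) * (p ^ j / (j + 4 : ℕ)) +
      bernoulli N * (N + 2).choose 2 * ((3 : ℕ) : ℚ)⁻¹), ?_, ?_⟩
  · refine mul_mem (ofNat_mem _ 2) (add_mem (sum_mem fun j _ => ?_) ?_)
    · refine mul_mem (mul_mem (mul_bernoulli_mem_pIntegers _) (natCast_mem _ _))
        (pow_div_mem_pIntegers (by omega) ?_)
      have h1 : 5 ^ (j + 1) ≤ p ^ (j + 1) := Nat.pow_le_pow_left h5 _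
      have h2 : j + 4 < 5 ^ (j + 1) := by
        clear * -
        induction j with
        | zero => norm_num
        | succ j ih => rw [pow_succ]; omega
      omega
    · refine mul_mem (mul_mem (bernoulli_mem_pIntegers hN) (natCast_mem _ _))
        (inv_natCast_mem_pIntegers fun h => ?_)
      have := Nat.le_of_dvd (by norm_num) h
      omega
  · rw [hsum, mul_add, mul_add, mul_add, mul_add, Finset.mul_sum, Finset.mul_sum, mul_add,
      Finset.mul_sum]
    have : ∀ j : ℕ, 2 * (bernoulli (N + 2 - (j + 1 + 1 + 1)) * ((N + 2).choose (j + 1 + 1 + 1)) *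
        ((p : ℚ) ^ (j + 1 + 1 + 1 + 1) / (j + 1 + 1 + 1 + 1 : ℕ))) =
        p ^ 3 * (2 * (((p * bernoulli (N + 2 - (j + 1 + 1 + 1))) *
    (N + 2).choose (j + 1 + 1 + 1)) * (p ^ j / (j + 4 : ℕ)))) := fun j => by
      rw [show j + 1 + 1 + 1 + 1 = j + 4 from rfl, pow_add]
      ring
    rw [Finset.sum_congr rfl fun j _ => this j]
    simp only [zero_add, Nat.choose_zero_right, Nat.choose_one_right, Nat.sub_zero,
      Nat.add_sub_cancel, show N + 2 - 1 = N + 1 from rfl, one_add_one_eq_two]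
    push_cast
    ring

end PIntegral

/-! ### The case of the rings `𝒜_n` -/

section FiniteValues

/-- Euler's theorem: the exponent `-a` may be replaced by `φ(pⁿ) - a`. -/
theorem inv_natCast_pow_eq {p n a m M : ℕ} (hp : p.Prime) (hm : m ∈ Finset.Ico 1 p)
    (hM : M + a = (p ^ n).totient) :
    ((m : ZMod (p ^ n))⁻¹) ^ a = (m : ZMod (p ^ n)) ^ M := by
  obtain ⟨h1, h2⟩ := Finset.mem_Ico.mp hm
  have hcop : m.Coprime (p ^ n) :=
    Nat.Coprime.pow_right n (Nat.Coprime.symm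
      ((Nat.Prime.coprime_iff_not_dvd hp).mpr fun h => by
        have := Nat.le_of_dvd h1 h; omega))
  have hinv : (m : ZMod (p ^ n)) * (m : ZMod (p ^ n))⁻¹ = 1 := ZMod.coe_mul_inv_eq_one m hcop
  have htot : (m : ZMod (p ^ n)) ^ (M + a) = 1 := by
    have := congrArg Units.val (ZMod.pow_totient (ZMod.unitOfCoprime m hcop))
    rw [hM]
    simpa only [Units.val_pow_eq_pow_val, ZMod.coe_unitOfCoprime, Units.val_one] using this
  calc ((m : ZMod (p ^ n))⁻¹) ^ a
      = (m : ZMod (p ^ n)) ^ (M + a) * ((m : ZMod (p ^ n))⁻¹) ^ a := by rw [htot, one_mul]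
    _ = (m : ZMod (p ^ n)) ^ M * ((m : ZMod (p ^ n)) * (m : ZMod (p ^ n))⁻¹) ^ a := by
        rw [pow_add, mul_pow, mul_assoc]
    _ = _ := by rw [hinv, one_pow, mul_one]

theorem ratMod_bernoulli_div_mul {p n : ℕ} [Fact p.Prime] {B : ℕ} {c : ℕ}
    (hB : ¬ (p - 1) ∣ B) (hc : ¬ p ∣ c) :
    ratMod (p ^ n) (bernoulli B / c) * (c : ZMod (p ^ n)) =
      pIntegersMod p n ⟨bernoulli B, bernoulli_mem_pIntegers hB⟩ := by
  have hmem : bernoulli B / c ∈ pIntegers p := by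
    rw [div_eq_mul_inv]
    exact mul_mem (bernoulli_mem_pIntegers hB) (inv_natCast_mem_pIntegers hc)
  have hc0 : (c : ℚ) ≠ 0 := by
    rintro h
    exact hc (by rw [Nat.cast_eq_zero.mp h]; exact dvd_zero p)
  rw [ratMod_eq_pIntegersMod p n ⟨_, hmem⟩, ← map_natCast (pIntegersMod p n), ← map_mul]
  congr 1
  exact Subtype.ext (div_mul_cancel₀ _ hc0)

/-- The component at `p` of `depthOneA n k`. -/
def depthOneAt (p n k : ℕ) : ZMod (p ^ n) :=
  ratMod (p ^ n) (bernoulli (p ^ (n - 1) * (p - 1) + 1 - k) / ((k : ℚ) - 1 + (p : ℚ) ^ (n - 1)))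

/-- The sums of `-a`-th powers below a large prime `p`, modulo `p²` and modulo `p³`. -/
theorem two_mul_sum_inv_pow {p n a : ℕ} (hp : p.Prime) (h2 : 2 ≤ n) (h3 : n ≤ 3) (ha : 0 < a)
    (hpa : a + 5 ≤ p) :
    2 * ∑ m ∈ Finset.Ico 1 p, ((m : ZMod (p ^ n))⁻¹) ^ a =
      2 * a * (depthOneAt p n (a + 1) * p) -
        a * (a + 1 : ℕ) * (depthOneAt p n (a + 2) * (p : ZMod (p ^ n)) ^ 2) := by
  have : Fact p.Prime := ⟨hp⟩
  obtain ⟨N, hN⟩ : ∃ N, p ^ (n - 1) * (p - 1) = N + 2 + a := by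
    have h1 : p - 1 ≤ p ^ (n - 1) * (p - 1) := Nat.le_mul_of_pos_left _ (pow_pos hp.pos _)
    exact ⟨p ^ (n - 1) * (p - 1) - 2 - a, by omega⟩
  have htot : N + 2 + a = (p ^ n).totient := by
    rw [Nat.totient_prime_pow hp (by omega), hN]
  -- Since `N + 2 + a = φ(pⁿ)` is a multiple of `p - 1`, divisibility would force `p - 1` to divide
  -- `a + 2 - j`, which lies between `1` and `p - 3`.
  have hndvd : ∀ j, j ≤ 2 → ¬ (p - 1) ∣ N + j := fun j hj h => by
    have h1 : (p - 1) ∣ (N + j) + (a + 2 - j) := by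
      rw [show N + j + (a + 2 - j) = N + 2 + a by omega, ← hN]
      exact Dvd.intro_left _ rfl
    have h2 := Nat.le_of_dvd (by omega) ((Nat.dvd_add_right h).mp h1)
    omega
  have hpdvd : ∀ b, 0 < b → b < p → ¬ p ∣ b + p ^ (n - 1) := fun b hb hbp h => by
    have h1 := (Nat.dvd_add_left (dvd_pow_self p (by omega : n - 1 ≠ 0))).mp h
    have := Nat.le_of_dvd hb h1
    omega
  obtain ⟨T, hT, hsum⟩ := exists_sum_pow_eq (p := p) (by omega) (N := N) (hndvd 0 (by omega))
  have hB2 := bernoulli_mem_pIntegers (hndvd 2 le_rfl)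
  have hB1 := bernoulli_mem_pIntegers (hndvd 1 one_le_two)
  have hsum' : (2 * ∑ m ∈ Finset.range p, (m : pIntegers p) ^ (N + 2)) =
      2 * p * ⟨bernoulli (N + 2), hB2⟩ + (N + 2 : ℕ) * p ^ 2 * ⟨bernoulli (N + 1), hB1⟩ +
        p ^ 3 * ⟨T, hT⟩ := by
    apply Subtype.ext
    have h2 : ((2 : pIntegers p) : ℚ) = 2 := rfl
    simpa [h2] using hsum
  have hmod := congrArg (pIntegersMod p n) hsum'
  simp only [map_add, map_mul, map_sum, map_pow, map_natCast, map_ofNat] at hmod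
  have hx3 : (p : ZMod (p ^ n)) ^ 3 = 0 := by
    refine pow_eq_zero_of_le h3 ?_
    rw [← Nat.cast_pow, ZMod.natCast_self]
  -- After multiplication by `p`, the summand `p^(n-1)` in the denominators of `depthOneAt` becomes
  -- invisible.
  have hxn : (p : ZMod (p ^ n)) * (p : ZMod (p ^ n)) ^ (n - 1) = 0 := by
    rw [← pow_succ', Nat.sub_add_cancel (by omega), ← Nat.cast_pow, ZMod.natCast_self]
  have hS : ∑ m ∈ Finset.Ico 1 p, ((m : ZMod (p ^ n))⁻¹) ^ a =
      ∑ m ∈ Finset.range p, (m : ZMod (p ^ n)) ^ (N + 2) := by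
    rw [Finset.range_eq_Ico, Finset.sum_eq_sum_Ico_succ_bot hp.pos]
    simp only [Nat.cast_zero, ne_eq, Nat.add_eq_zero_iff, OfNat.ofNat_ne_zero, and_false,
      not_false_eq_true, zero_pow, zero_add]
    exact Finset.sum_congr rfl fun m hm => inv_natCast_pow_eq hp hm htot
  have hD1 : depthOneAt p n (a + 1) * ((a + p ^ (n - 1) : ℕ) : ZMod (p ^ n)) =
      pIntegersMod p n ⟨bernoulli (N + 2), hB2⟩ := by
    rw [← ratMod_bernoulli_div_mul (hndvd 2 le_rfl) (hpdvd a ha (by omega)), depthOneAt, hN,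
      show N + 2 + a + 1 - (a + 1) = N + 2 by omega]
    congr 3
    push_cast
    ring
  have hD2 : depthOneAt p n (a + 2) * ((a + 1 + p ^ (n - 1) : ℕ) : ZMod (p ^ n)) =
      pIntegersMod p n ⟨bernoulli (N + 1), hB1⟩ := by
    rw [← ratMod_bernoulli_div_mul (hndvd 1 one_le_two) (hpdvd (a + 1) (by omega) (by omega)),
      depthOneAt, hN, show N + 2 + a + 1 - (a + 2) = N + 1 by omega]
    congr 3
    push_cast
    ring
  -- `N + 2 ≡ -a` modulo `p^(n-1)`; this is the origin of the minus sign of the quadratic term.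
  have hMa : ((N + 2 : ℕ) : ZMod (p ^ n)) * (p : ZMod (p ^ n)) = -a * p := by
    have h1 : ((p ^ (n - 1) * (p - 1) : ℕ) : ZMod (p ^ n)) = ((N + 2 + a : ℕ) : ZMod (p ^ n)) := by
      rw [hN]
    rw [Nat.cast_mul, Nat.cast_pow, Nat.cast_add (N + 2)] at h1
    linear_combination -(p : ZMod (p ^ n)) * h1 + ((p - 1 : ℕ) : ZMod (p ^ n)) * hxn
  rw [hS, hmod, ← hD1, ← hD2]
  push_cast at hMa ⊢
  linear_combination (2 * depthOneAt p n (a + 1) - a * p * depthOneAt p n (a + 2)) * hxn +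
    p * depthOneAt p n (a + 2) * (a + 1 + p ^ (n - 1)) * hMa +
    pIntegersMod p n ⟨T, hT⟩ * hx3

/-- The Bernoulli index is odd and exceeds `1`. This is the finite counterpart of the vanishing of
even zeta values modulo `ζ(2)`. -/
theorem depthOneAt_eq_zero {p n k : ℕ} (hp : p.Prime) (hk : Even k) (hk2 : 2 ≤ k)
    (hpk : k + 5 ≤ p) : depthOneAt p n k = 0 := by
  have h1 : p - 1 ≤ p ^ (n - 1) * (p - 1) := Nat.le_mul_of_pos_left _ (pow_pos hp.pos _)
  have hev : Even (p ^ (n - 1) * (p - 1)) := by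
    refine Even.mul_left ?_ _
    exact (hp.odd_of_ne_two (by omega)).tsub_odd odd_one
  have hodd : Odd (p ^ (n - 1) * (p - 1) + 1 - k) :=
    Nat.Odd.sub_even (by omega) hev.add_one hk
  rw [depthOneAt, bernoulli_eq_zero_of_odd hodd (by omega)]
  simp [ratMod]

/-- By parity only one of the two terms is present, so the relative minus sign can be traded for the
global sign `(-1)^m` found on the `𝒮` side. -/
theorem sub_eq_neg_one_pow_mul_add {R : Type*} [CommRing R] (m : ℕ) {d₁ d₂ x : R}
    (h1 : Odd m → d₁ = 0) (h2 : Even m → d₂ = 0) :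
    2 * (m : R) * (d₁ * x) - (m : R) * ((m + 1 : ℕ) : R) * (d₂ * x ^ 2) =
      (-1) ^ m * (2 * (m : R) * (d₁ * x) + (m : R) * ((m + 1 : ℕ) : R) * (d₂ * x ^ 2)) := by
  rcases Nat.even_or_odd m with hev | hodd
  · rw [hev.neg_one_pow, h2 hev]
    ring
  · rw [hodd.neg_one_pow, h1 hodd]
    ring

variable (n : ℕ)

/-- `ARing.mk` as a ring homomorphism. -/
def ARing.mkHom : ((p : Nat.Primes) → ZMod ((p : ℕ) ^ n)) →+* ARing n :=
  Ideal.Quotient.mk (finiteSupportIdeal n)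

theorem ARing.mkHom_apply (f) : ARing.mkHom n f = ARing.mk n f := rfl

variable {n}

theorem ARing.mk_eq_mk {f g : (p : Nat.Primes) → ZMod ((p : ℕ) ^ n)} (N : ℕ)
    (h : ∀ p : Nat.Primes, N ≤ p → f p = g p) : ARing.mk n f = ARing.mk n g := by
  rw [ARing.mk, ARing.mk, Ideal.Quotient.mk_eq_mk_iff_sub_mem]
  have hfin : {p : Nat.Primes | (p : ℕ) ≤ N}.Finite := by
    refine Set.Finite.of_finite_image (f := fun p : Nat.Primes => (p : ℕ)) ?_
      (fun a _ b _ h => Subtype.ext h)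
    refine (Set.finite_le_nat N).subset ?_
    rintro _ ⟨p, hp, rfl⟩
    exact hp
  refine hfin.subset fun p hp => ?_
  by_contra hlt
  exact hp (sub_eq_zero.mpr (h p (not_le.mp hlt).le))

/-- The list of the inverses of `1, …, p - 1` modulo `pⁿ`. -/
def invList (p n : ℕ) : List (ZMod (p ^ n)) :=
  (List.range' 1 (p - 1)).map fun m : ℕ => (m : ZMod (p ^ n))⁻¹

theorem Ioo_zero_prime (p : Nat.Primes) :
    Finset.Ioo 0 (p : ℕ) = Finset.Ico 1 (1 + ((p : ℕ) - 1)) := by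
  ext m
  simp only [Finset.mem_Ioo, Finset.mem_Ico]
  have := p.2.pos
  omega

theorem zetaA_eq (k : List ℕ+) : zetaA n k = ARing.mk n fun p => quasiSum k (invList p n) := by
  rw [zetaA]
  congr 1
  funext p
  rw [invList, ← sum_strictMono_eq_quasiSum]
  simp only [Ioo_zero_prime]

theorem zetaStarA_eq (k : List ℕ+) :
    zetaStarA n k = ARing.mk n fun p => quasiSumStar k (invList p n) := by
  rw [zetaStarA]
  congr 1
  funext p
  rw [invList, ← sum_monotone_eq_quasiSumStar]
  simp only [Ioo_zero_prime]

theorem zetaA_newton (k : ℕ+) (r : ℕ) :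
    ((r + 1 : ℕ) : ARing n) * zetaA n (List.replicate (r + 1) k) =
      ∑ j ∈ Finset.range (r + 1),
        (-1) ^ j * zetaA n [j.succPNat * k] * zetaA n (List.replicate (r - j) k) := by
  simp only [zetaA_eq, ← ARing.mkHom_apply]
  rw [← map_natCast (ARing.mkHom n), ← map_mul, ← map_one (ARing.mkHom n)]
  simp only [← map_neg, ← map_pow, ← map_mul, ← map_sum]
  congr 1
  funext p
  simpa using newton_quasiSum k (invList p n) r

theorem sum_zetaA_mul_zetaStarA (k : ℕ+) (r : ℕ) :
    ∑ i ∈ Finset.range (r + 2), (-1) ^ i * zetaA n (List.replicate i k) *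
      zetaStarA n (List.replicate (r + 1 - i) k) = 0 := by
  simp only [zetaA_eq, zetaStarA_eq, ← ARing.mkHom_apply]
  rw [← map_one (ARing.mkHom n), ← map_zero (ARing.mkHom n)]
  simp only [← map_neg, ← map_pow, ← map_mul, ← map_sum]
  congr 1
  funext p
  simpa using sum_quasiSum_mul_quasiSumStar k (invList p n) r

theorem two_mul_zetaA_singleton (h2 : 2 ≤ n) (h3 : n ≤ 3) (a : ℕ+) :
    2 * zetaA n [a] = 2 * ((a : ℕ) : ARing n) * (depthOneA n (a + 1) * xA n) -
      ((a : ℕ) : ARing n) * ((a + 1 : ℕ) : ARing n) * (depthOneA n (a + 2) * xA n ^ 2) := by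
  rw [zetaA_eq, depthOneA, depthOneA, xA]
  simp only [← ARing.mkHom_apply]
  rw [← map_natCast (ARing.mkHom n), ← map_natCast (ARing.mkHom n), ← map_ofNat (ARing.mkHom n)]
  simp only [← map_pow, ← map_mul, ← map_sub]
  refine ARing.mk_eq_mk (a + 5) fun p hp => ?_
  have h := two_mul_sum_inv_pow p.2 h2 h3 a.pos hp
  have hs : quasiSum [a] (invList p n) =
      ∑ m ∈ Finset.Ico 1 (p : ℕ), ((m : ZMod ((p : ℕ) ^ n))⁻¹) ^ (a : ℕ) := by
    rw [quasiSum_singleton, invList, List.map_map, Finset.sum_eq_multiset_sum,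
      show Finset.Ico 1 (p : ℕ) = ⟨Multiset.Ico 1 (p : ℕ), _⟩ from rfl]
    rfl
  rw [← hs] at h
  exact h

theorem depthOneA_eq_zero {k : ℕ} (hk : Even k) (hk2 : 2 ≤ k) : depthOneA n k = 0 := by
  rw [depthOneA, ← map_zero (ARing.mkHom n)]
  exact ARing.mk_eq_mk (k + 5) fun p hp => depthOneAt_eq_zero p.2 hk hk2 hp

theorem xA_pow_self : xA n ^ n = 0 := by
  rw [xA, ← ARing.mkHom_apply, ← map_pow, ← map_zero (ARing.mkHom n)]
  congr 1
  funext p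
  rw [Pi.pow_apply, ← Nat.cast_pow, ZMod.natCast_self]
  rfl

theorem zetaA_nil : zetaA n [] = 1 := by
  simp only [zetaA_eq, quasiSum_nil]
  exact map_one (ARing.mkHom n)

theorem zetaStarA_nil : zetaStarA n [] = 1 := by
  simp only [zetaStarA_eq, quasiSumStar_nil]
  exact map_one (ARing.mkHom n)

theorem zetaA_two_replicate (r : ℕ) (hr : 0 < r) (k : ℕ+) :
    zetaA 2 (List.replicate r k) =
        ((-1) ^ (r - 1) * (k : ℚ)) • (depthOneA 2 (r * k + 1) * xA 2) ∧
      zetaStarA 2 (List.replicate r k) = (k : ℚ) • (depthOneA 2 (r * k + 1) * xA 2) := by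
  refine closed_form_of_sq_eq_zero (R := ARing 2) (e := fun i => zetaA 2 (List.replicate i k))
    (h := fun i => zetaStarA 2 (List.replicate i k))
    (P := fun j => zetaA 2 [(j - 1).succPNat * k]) (D := depthOneA 2)
    (k : ℕ) (xA_pow_self (n := 2)) zetaA_nil zetaStarA_nil (zetaA_newton k)
    (sum_zetaA_mul_zetaStarA k) (fun j => ?_) r hr
  apply two_mul_cancel
  rw [two_mul_zetaA_singleton le_rfl (by norm_num), xA_pow_self]
  simp only [PNat.mul_coe, Nat.succPNat_coe, Nat.add_sub_cancel, Nat.succ_eq_add_one]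
  ring

theorem zetaA_three_replicate (r : ℕ) (hr : 0 < r) (k : ℕ+) :
    zetaA 3 (List.replicate r k) =
        ((-1) ^ (r * k + r - 1) : ℚ) •
          ((k : ℚ) • (depthOneA 3 (r * k + 1) * xA 3) +
            (((k : ℚ) * (r * k + 1) / 2) • depthOneA 3 (r * k + 2) -
              ((k : ℚ) ^ 2 / 2) • ∑ l ∈ Finset.Icc 1 (r - 1),
                depthOneA 3 (l * k + 1) * depthOneA 3 ((r - l) * k + 1)) * xA 3 ^ 2) ∧
      zetaStarA 3 (List.replicate r k) =
        ((-1) ^ (r * k) : ℚ) •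
          ((k : ℚ) • (depthOneA 3 (r * k + 1) * xA 3) +
            (((k : ℚ) * (r * k + 1) / 2) • depthOneA 3 (r * k + 2) +
              ((k : ℚ) ^ 2 / 2) • ∑ l ∈ Finset.Icc 1 (r - 1),
                depthOneA 3 (l * k + 1) * depthOneA 3 ((r - l) * k + 1)) * xA 3 ^ 2) := by
  refine closed_form_of_cube_eq_zero (R := ARing 3) (e := fun i => zetaA 3 (List.replicate i k))
    (h := fun i => zetaStarA 3 (List.replicate i k))
    (P := fun j => zetaA 3 [(j - 1).succPNat * k]) (D := depthOneA 3)
    (k : ℕ) (xA_pow_self (n := 3)) zetaA_nil zetaStarA_nil (zetaA_newton k)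
    (sum_zetaA_mul_zetaStarA k) (fun j => ?_) r hr
  rw [two_mul_zetaA_singleton (by norm_num) le_rfl]
  simp only [PNat.mul_coe, Nat.succPNat_coe, Nat.add_sub_cancel, Nat.succ_eq_add_one]
  have hpos : 0 < (j + 1) * (k : ℕ) := Nat.mul_pos (Nat.succ_pos j) k.pos
  exact sub_eq_neg_one_pow_mul_add (R := ARing 3) _
    (fun hodd => depthOneA_eq_zero hodd.add_one (by omega))
    (fun hev => depthOneA_eq_zero (hev.add even_two) (by omega))

end FiniteValues

/-! ### The harmonic algebra -/

section Harmonic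

/-- The harmonic product as a bilinear map. -/
def harmonicMulₗ : H1 →ₗ[ℚ] H1 →ₗ[ℚ] H1 :=
  Finsupp.linearCombination ℚ fun u => Finsupp.linearCombination ℚ (harmonicWord u)

theorem harmonicMul_eq (f g : H1) : harmonicMul f g = harmonicMulₗ f g := by
  rw [harmonicMul, harmonicMulₗ, Finsupp.linearCombination_apply, Finsupp.sum, Finsupp.sum,
    LinearMap.sum_apply]
  refine Finset.sum_congr rfl fun u _ => ?_
  rw [LinearMap.smul_apply, Finsupp.linearCombination_apply, Finsupp.smul_sum]
  simp only [mul_smul]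

@[simp]
theorem harmonicMulₗ_word_word (u v : List ℕ+) :
    harmonicMulₗ (word u) (word v) = harmonicWord u v := by
  simp [harmonicMulₗ, word]

@[simp]
theorem prepend_word (a : ℕ+) (u : List ℕ+) : prepend a (word u) = word (a :: u) := by
  simp [prepend, word, Finsupp.lmapDomain_apply]

theorem H1_hom_ext {M : Type*} [AddCommMonoid M] [Module ℚ M] {φ ψ : H1 →ₗ[ℚ] M}
    (h : ∀ u, φ (word u) = ψ (word u)) : φ = ψ :=
  Finsupp.lhom_ext' fun u => LinearMap.ext_ring (h u)

@[simp]
theorem harmonicMulₗ_nil_left (f : H1) : harmonicMulₗ (word []) f = f := by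
  have : harmonicMulₗ (word []) = LinearMap.id :=
    H1_hom_ext fun u => by rw [harmonicMulₗ_word_word, harmonicWord]; rfl
  rw [this, LinearMap.id_apply]

@[simp]
theorem harmonicMulₗ_nil_right (f : H1) : harmonicMulₗ f (word []) = f := by
  have : harmonicMulₗ.flip (word []) = LinearMap.id :=
    H1_hom_ext fun u => by
      rw [LinearMap.flip_apply, harmonicMulₗ_word_word]
      cases u <;> rw [harmonicWord] <;> rfl
  rw [← LinearMap.flip_apply, this, LinearMap.id_apply]

theorem harmonicMulₗ_prepend_prepend (a b : ℕ+) (f g : H1) :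
    harmonicMulₗ (prepend a f) (prepend b g) =
      prepend a (harmonicMulₗ f (prepend b g)) + prepend b (harmonicMulₗ (prepend a f) g) +
        prepend (a + b) (harmonicMulₗ f g) := by
  induction f using Finsupp.induction_linear with
  | zero => simp
  | add f₁ f₂ h₁ h₂ =>
    simp only [map_add, LinearMap.add_apply, h₁, h₂]
    abel
  | single u x =>
    have hx : Finsupp.single u x = x • word u := by simp [word]
    rw [hx]
    simp only [map_smul, LinearMap.smul_apply, ← smul_add]
    congr 1
    induction g using Finsupp.induction_linear with
    | zero => simp
    | add f₁ f₂ h₁ h₂ =>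
      simp only [map_add, h₁, h₂]
      abel
    | single v y =>
      have hy : Finsupp.single v y = y • word v := by simp [word]
      rw [hy]
      simp only [map_smul, ← smul_add]
      congr 1
      simp only [prepend_word, harmonicMulₗ_word_word]
      rw [harmonicWord]

theorem harmonicMulₗ_assoc_word (u v w : List ℕ+) :
    harmonicMulₗ (harmonicMulₗ (word u) (word v)) (word w) =
      harmonicMulₗ (word u) (harmonicMulₗ (word v) (word w)) := by
  match u, v, w with
  | [], v, w => rw [harmonicMulₗ_nil_left, harmonicMulₗ_nil_left]
  | u, [], w => rw [harmonicMulₗ_nil_left, harmonicMulₗ_nil_right]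
  | u, v, [] => rw [harmonicMulₗ_nil_right, harmonicMulₗ_nil_right]
  | a :: u, b :: v, c :: w =>
    -- One instance for each nonempty set of words that lose their first letter; `h1`, `h2`, `h4`
    -- still need the removed letter prepended.
    have h1 := harmonicMulₗ_assoc_word u (b :: v) (c :: w)
    have h2 := harmonicMulₗ_assoc_word (a :: u) v (c :: w)
    have h3 := harmonicMulₗ_assoc_word u v (c :: w)
    have h4 := harmonicMulₗ_assoc_word (a :: u) (b :: v) w
    have h5 := harmonicMulₗ_assoc_word u (b :: v) w
    have h6 := harmonicMulₗ_assoc_word (a :: u) v w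
    have h7 := harmonicMulₗ_assoc_word u v w
    simp only [← prepend_word, harmonicMulₗ_prepend_prepend, map_add, LinearMap.add_apply,
      add_assoc] at h1 h2 h3 h4 h5 h6 h7 ⊢
    have h1' := congrArg (prepend a) h1
    have h2' := congrArg (prepend b) h2
    have h4' := congrArg (prepend c) h4
    simp only [map_add] at h1' h2' h4'
    rw [h3, h5, h6, h7]
    linear_combination (norm := module) h1' + h2' + h4'
termination_by u.length + v.length + w.length

theorem harmonicMulₗ_assoc (f g h : H1) :
    harmonicMulₗ (harmonicMulₗ f g) h = harmonicMulₗ f (harmonicMulₗ g h) := by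
  induction f using Finsupp.induction_linear with
  | zero => simp
  | add f₁ f₂ h₁ h₂ => simp only [map_add, LinearMap.add_apply, h₁, h₂]
  | single u x =>
    have hx : Finsupp.single u x = x • word u := by simp [word]
    rw [hx]
    simp only [map_smul, LinearMap.smul_apply]
    congr 1
    induction g using Finsupp.induction_linear with
    | zero => simp
    | add f₁ f₂ h₁ h₂ => simp only [map_add, LinearMap.add_apply, h₁, h₂]
    | single v y =>
      have hy : Finsupp.single v y = y • word v := by simp [word]
      rw [hy]
      simp only [map_smul, LinearMap.smul_apply]
      congr 1
      induction h using Finsupp.induction_linear with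
      | zero => simp
      | add f₁ f₂ h₁ h₂ => simp only [map_add, h₁, h₂]
      | single w z =>
        have hz : Finsupp.single w z = z • word w := by simp [word]
        rw [hz]
        simp only [map_smul]
        rw [harmonicMulₗ_assoc_word]

/-! ### Existence of the harmonic regularization -/

/-- The linear map `(aᵢ)ᵢ ↦ ∑ᵢ aᵢ * e₁^{*i}` on `ℌ⁰`-valued families. -/
def sumMulPow : (ℕ →₀ H0) →ₗ[ℚ] H1 :=
  Finsupp.lsum ℚ fun i => (harmonicMulₗ.flip (harmonicPowE1 i)).comp H0.subtype

theorem sumMulPow_single (i : ℕ) (c : H0) :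
    sumMulPow (Finsupp.single i c) = harmonicMulₗ c (harmonicPowE1 i) := by
  simp [sumMulPow]

theorem exists_isHarmonicReg_of_mem_range {f : H1} (hf : f ∈ LinearMap.range sumMulPow) :
    ∃ b, IsHarmonicReg f b := by
  obtain ⟨c, rfl⟩ := hf
  refine ⟨c 0, c.support.sup id, fun i => c i, fun i => (c i).2, ?_, rfl⟩
  rw [sumMulPow, Finsupp.lsum_apply, Finsupp.sum_of_support_subset (s := Finset.range
    (c.support.sup id + 1)) _ _ _ (fun i _ => by simp)]
  · exact Finset.sum_congr rfl fun i _ => by rw [harmonicMul_eq]; rfl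
  · intro i hi
    exact Finset.mem_range_succ_iff.mpr (Finset.le_sup (f := id) hi)

theorem mem_range_sumMulPow_of_mem_H0 {f : H1} (hf : f ∈ H0) :
    f ∈ LinearMap.range sumMulPow :=
  ⟨Finsupp.single 0 ⟨f, hf⟩, by rw [sumMulPow_single, harmonicPowE1, harmonicMulₗ_nil_right]⟩

theorem harmonicMulₗ_e1_mem_range {f : H1} (hf : f ∈ LinearMap.range sumMulPow) :
    harmonicMulₗ f (word [1]) ∈ LinearMap.range sumMulPow := by
  obtain ⟨c, rfl⟩ := hf
  induction c using Finsupp.induction_linear with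
  | zero => simp
  | add f g hf hg =>
    rw [map_add, map_add, LinearMap.add_apply]
    exact add_mem hf hg
  | single i c =>
    refine ⟨Finsupp.single (i + 1) c, ?_⟩
    rw [sumMulPow_single, sumMulPow_single, harmonicPowE1, harmonicMul_eq, harmonicMulₗ_assoc]

theorem admissible_nil : Admissible [] := by simp [Admissible]

theorem admissible_concat {u : List ℕ+} {a : ℕ+} : Admissible (u ++ [a]) ↔ 2 ≤ a := by
  simp [Admissible]

theorem Admissible.tail {a : ℕ+} {u : List ℕ+} (h : Admissible (a :: u)) : Admissible u := by
  cases u with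
  | nil => exact admissible_nil
  | cons b u => simpa [Admissible] using h

theorem Admissible.cons {a : ℕ+} {u : List ℕ+} (h : Admissible u) (hu : u ≠ []) :
    Admissible (a :: u) := by
  cases u with
  | nil => exact absurd rfl hu
  | cons b u => simpa [Admissible] using h

theorem Admissible.add_cons {a b : ℕ+} {u : List ℕ+} (h : Admissible u) :
    Admissible ((a + b) :: u) := by
  cases u with
  | nil =>
    have h1 := a.pos
    have h2 := b.pos
    simp only [Admissible, List.getLast?_singleton, Option.mem_def, Option.some.injEq,
      forall_eq', ← PNat.coe_le_coe, PNat.add_coe]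
    change 2 ≤ _
    omega
  | cons b u => exact h.cons (by simp)

theorem exists_eq_append_replicate_one (u : List ℕ+) :
    ∃ v m, Admissible v ∧ u = v ++ List.replicate m 1 := by
  induction u using List.reverseRecOn with
  | nil => exact ⟨[], 0, admissible_nil, rfl⟩
  | append_singleton u a ih =>
    by_cases ha : a = 1
    · obtain ⟨v, m, hv, rfl⟩ := ih
      exact ⟨v, m + 1, hv, by rw [ha, List.replicate_succ', List.append_assoc]⟩
    · refine ⟨u ++ [a], 0, admissible_concat.mpr ?_, by simp⟩
      exact PNat.add_one_le_iff.mpr (lt_of_le_of_ne one_le (Ne.symm ha))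

/-- The span of the words `v 1 ⋯ 1` with `v` admissible and non-empty and at most `m` ones. -/
def trailingOnes (m : ℕ) : Submodule ℚ H1 :=
  Submodule.span ℚ {f | ∃ v j, Admissible v ∧ v ≠ [] ∧ j ≤ m ∧
    f = word (v ++ List.replicate j 1)}

theorem trailingOnes_mono {m m' : ℕ} (h : m ≤ m') : trailingOnes m ≤ trailingOnes m' :=
  Submodule.span_mono fun _ ⟨v, j, hv, hv', hj, hf⟩ => ⟨v, j, hv, hv', hj.trans h, hf⟩

theorem prepend_mem_trailingOnes {m : ℕ} (a : ℕ+) {f : H1} (hf : f ∈ trailingOnes m) :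
    prepend a f ∈ trailingOnes m := by
  induction hf using Submodule.span_induction with
  | mem f hf =>
    obtain ⟨v, j, hv, hv', hj, rfl⟩ := hf
    exact Submodule.subset_span ⟨a :: v, j, hv.cons hv', by simp, hj, by rw [prepend_word]; rfl⟩
  | zero => rw [map_zero]; exact zero_mem _
  | add f g _ _ hf hg => rw [map_add]; exact add_mem hf hg
  | smul c f _ hf => rw [map_smul]; exact Submodule.smul_mem _ c hf

theorem harmonicWord_cons_one (a : ℕ+) (u : List ℕ+) :
    harmonicWord (a :: u) [1] =
      prepend a (harmonicWord u [1]) + word (1 :: a :: u) + word ((a + 1) :: u) := by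
  rw [harmonicWord]
  congr 2
  · rw [harmonicWord, prepend_word]
  · cases u <;> rw [harmonicWord, prepend_word]

/-- Triangularity of multiplication by `e_1`: inserting a `1` into the final block of ones gives the
same word `m + 1` times, while every other insertion or merger leaves at most `m` trailing ones
after a nonempty admissible head. -/
theorem harmonicWord_one_sub_mem (v : List ℕ+) (hv : Admissible v) (m : ℕ) :
    harmonicWord (v ++ List.replicate m 1) [1] -
      ((m + 1 : ℕ) : ℚ) • word (v ++ List.replicate (m + 1) 1) ∈ trailingOnes m := by
  induction v with
  | nil =>
    induction m with
    | zero => simp [harmonicWord]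
    | succ m ih =>
      have h1 := prepend_mem_trailingOnes 1 (trailingOnes_mono m.le_succ ih)
      have h2 : word ((1 + 1) :: List.replicate m 1) ∈ trailingOnes (m + 1) :=
        Submodule.subset_span ⟨[1 + 1], m, admissible_nil.add_cons, by simp, m.le_succ, rfl⟩
      have := add_mem h1 h2
      simp only [List.nil_append, map_sub, map_smul, prepend_word] at this ⊢
      rw [List.replicate_succ, harmonicWord_cons_one]
      convert this using 1
      simp only [List.replicate_succ]
      push_cast
      module
  | cons a v ih =>
    have h1 := prepend_mem_trailingOnes a (ih hv.tail)
    have h2 : word (1 :: a :: (v ++ List.replicate m 1)) ∈ trailingOnes m :=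
      Submodule.subset_span ⟨1 :: a :: v, m, hv.cons (by simp), by simp, le_rfl, rfl⟩
    have h3 : word ((a + 1) :: (v ++ List.replicate m 1)) ∈ trailingOnes m :=
      Submodule.subset_span ⟨(a + 1) :: v, m, hv.tail.add_cons, by simp, le_rfl, rfl⟩
    have := add_mem (add_mem h1 h2) h3
    rw [map_sub, map_smul, prepend_word] at this
    rw [List.cons_append, List.cons_append, harmonicWord_cons_one]
    convert this using 1
    abel

/-- Strong induction on the number of trailing ones: the triangular relation is solved for its
leading word by dividing by `m + 1`. -/
theorem word_append_replicate_mem_range (m : ℕ) (v : List ℕ+) (hv : Admissible v) :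
    word (v ++ List.replicate m 1) ∈ LinearMap.range sumMulPow := by
  induction m using Nat.strong_induction_on generalizing v with
  | _ m ih =>
    cases m with
    | zero =>
      refine mem_range_sumMulPow_of_mem_H0 (Submodule.subset_span ⟨v, hv, by simp⟩)
    | succ m =>
      have h1 := harmonicMulₗ_e1_mem_range (ih m m.lt_succ_self v hv)
      rw [harmonicMulₗ_word_word] at h1
      have h2 : trailingOnes m ≤ LinearMap.range sumMulPow := by
        refine Submodule.span_le.mpr ?_
        rintro _ ⟨v, j, hv, -, hj, rfl⟩
        exact ih j (Nat.lt_succ_of_le hj) v hv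
      have h3 := sub_mem h1 (h2 (harmonicWord_one_sub_mem v hv m))
      rw [sub_sub_cancel] at h3
      exact (Submodule.smul_mem_iff _ (by positivity)).mp h3

/-- Existence is enough to control the `epsilon` choice. Its value under `evalZ` is pinned down by
uniqueness of asymptotic expansions instead of algebraic uniqueness in `ℌ¹`. -/
theorem isHarmonicReg_harmonicReg (u : List ℕ+) : IsHarmonicReg (word u) (harmonicReg (word u)) := by
  obtain ⟨v, m, hv, rfl⟩ := exists_eq_append_replicate_one u
  exact Classical.epsilon_spec
    (exists_isHarmonicReg_of_mem_range (word_append_replicate_mem_range m v hv))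

end Harmonic

open Filter Topology Polynomial

/-! ### Asymptotic expansions of truncated multiple zeta values -/

section Homomorphism

variable {R : Type*} [CommRing R] [Algebra ℚ R]

/-- The linear extension of `quasiSum` to `ℌ¹`. -/
def quasiSumₗ (xs : List R) : H1 →ₗ[ℚ] R := Finsupp.linearCombination ℚ fun u => quasiSum u xs

@[simp]
theorem quasiSumₗ_word (xs : List R) (u : List ℕ+) : quasiSumₗ xs (word u) = quasiSum u xs := by
  simp [quasiSumₗ, word]

@[simp]
theorem quasiSumₗ_prepend_nil (a : ℕ+) (f : H1) : quasiSumₗ ([] : List R) (prepend a f) = 0 := by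
  have : quasiSumₗ ([] : List R) ∘ₗ prepend a = 0 := H1_hom_ext fun u => by simp
  exact LinearMap.congr_fun this f

theorem quasiSumₗ_prepend_cons (a : ℕ+) (f : H1) (x : R) (xs : List R) :
    quasiSumₗ (x :: xs) (prepend a f) =
      x ^ (a : ℕ) * quasiSumₗ xs f + quasiSumₗ xs (prepend a f) := by
  have : quasiSumₗ (x :: xs) ∘ₗ prepend a =
      LinearMap.mulLeft ℚ (x ^ (a : ℕ)) ∘ₗ quasiSumₗ xs + quasiSumₗ xs ∘ₗ prepend a :=
    H1_hom_ext fun u => by simp [quasiSum_cons_cons]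
  exact LinearMap.congr_fun this f

/-- The product of two strict sums splits according to which leading variable comes first or whether
they coincide: these are the three terms of the harmonic product. -/
theorem quasiSumₗ_harmonicWord (xs : List R) (u v : List ℕ+) :
    quasiSumₗ xs (harmonicWord u v) = quasiSum u xs * quasiSum v xs := by
  induction xs generalizing u v with
  | nil =>
    match u, v with
    | [], v => rw [harmonicWord]; simp
    | a :: u, [] => rw [harmonicWord]; simp
    | a :: u, b :: v => rw [harmonicWord]; simp
  | cons x xs ih =>
    match u, v with
    | [], v => rw [harmonicWord]; simp
    | a :: u, [] => rw [harmonicWord]; simp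
    | a :: u, b :: v =>
      have h := ih (a :: u) (b :: v)
      rw [harmonicWord] at h ⊢
      simp only [map_add, quasiSumₗ_prepend_cons, ih, quasiSum_cons_cons, PNat.add_coe,
        pow_add] at h ⊢
      linear_combination h

theorem quasiSumₗ_harmonicMulₗ (xs : List R) (f g : H1) :
    quasiSumₗ xs (harmonicMulₗ f g) = quasiSumₗ xs f * quasiSumₗ xs g := by
  have : (harmonicMulₗ.compr₂ (quasiSumₗ xs)) =
      (LinearMap.mul ℚ R).compl₁₂ (quasiSumₗ xs) (quasiSumₗ xs) :=
    H1_hom_ext fun u => H1_hom_ext fun v => by simp [quasiSumₗ_harmonicWord]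
  exact LinearMap.congr_fun₂ this f g

theorem quasiSumₗ_harmonicPowE1 (xs : List R) (i : ℕ) :
    quasiSumₗ xs (harmonicPowE1 i) = quasiSum [1] xs ^ i := by
  induction i with
  | zero => simp [harmonicPowE1]
  | succ i ih => rw [harmonicPowE1, harmonicMul_eq, quasiSumₗ_harmonicMulₗ, ih, pow_succ,
      quasiSumₗ_word]

end Homomorphism

/-- The list `1, 1/2, …, 1/N`. -/
def reciprocals (N : ℕ) : List ℝ := (List.range' 1 N).map fun m : ℕ => (m : ℝ)⁻¹

/-- The `N`-th harmonic number. -/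
def harm (N : ℕ) : ℝ := quasiSum [1] (reciprocals N)

theorem reciprocals_succ (N : ℕ) :
    reciprocals (N + 1) = reciprocals N ++ [((N + 1 : ℕ) : ℝ)⁻¹] := by
  rw [reciprocals, List.range'_1_concat, List.map_append, add_comm 1 N]
  rfl

theorem reciprocals_nonneg {N : ℕ} {x : ℝ} (hx : x ∈ reciprocals N) : 0 ≤ x ∧ x ≤ 1 := by
  obtain ⟨m, hm, rfl⟩ := List.mem_map.mp hx
  have h1 : 1 ≤ m := (List.mem_range'_1.mp hm).1
  exact ⟨by positivity, inv_le_one_of_one_le₀ (by exact_mod_cast h1)⟩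

theorem harm_succ (N : ℕ) : harm (N + 1) = harm N + ((N + 1 : ℕ) : ℝ)⁻¹ := by
  rw [harm, harm, quasiSum_singleton, quasiSum_singleton, reciprocals_succ]
  simp

theorem harm_eq (N : ℕ) : harm N = (harmonic N : ℝ) := by
  induction N with
  | zero => simp [harm, reciprocals]
  | succ N ih => rw [harm_succ, ih, harmonic_succ]; push_cast; ring

theorem harm_nonneg (N : ℕ) : 0 ≤ harm N := by
  induction N with
  | zero => simp [harm, reciprocals]
  | succ N ih => rw [harm_succ]; positivity

theorem harm_mono : Monotone harm :=
  monotone_nat_of_le_succ fun N => by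
    rw [harm_succ]
    exact le_add_of_nonneg_right (by positivity)

theorem tendsto_harm : Tendsto harm atTop atTop := by
  refine Real.tendsto_sum_range_one_div_nat_succ_atTop.congr fun N => ?_
  induction N with
  | zero => simp [harm, reciprocals]
  | succ N ih => rw [Finset.sum_range_succ, ih, harm_succ]; push_cast; ring

theorem quasiSum_nonneg_and_le (u : List ℕ+) (xs : List ℝ) (hx : ∀ x ∈ xs, 0 ≤ x ∧ x ≤ 1) :
    0 ≤ quasiSum u xs ∧ quasiSum u xs ≤ quasiSum [1] xs ^ u.length := by
  induction xs generalizing u with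
  | nil => cases u <;> simp
  | cons x xs ih =>
    have hx' : ∀ y ∈ xs, 0 ≤ y ∧ y ≤ 1 := fun y hy => hx y (List.mem_cons_of_mem _ hy)
    obtain ⟨h0, h1⟩ := hx x List.mem_cons_self
    cases u with
    | nil => simp
    | cons a u =>
      have i1 := ih u hx'
      have i2 := ih (a :: u) hx'
      have i3 := (ih [1] hx').1
      have hxa : x ^ (a : ℕ) ≤ x := pow_le_of_le_one h0 h1 a.ne_zero
      have hxa0 : 0 ≤ x ^ (a : ℕ) := pow_nonneg h0 _
      rw [quasiSum_cons_cons, quasiSum_cons_cons, quasiSum_nil, PNat.one_coe, pow_one, mul_one]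
      refine ⟨add_nonneg (mul_nonneg hxa0 i1.1) i2.1, ?_⟩
      set S := quasiSum [1] xs
      calc x ^ (a : ℕ) * quasiSum u xs + quasiSum (a :: u) xs
          ≤ x * S ^ u.length + S ^ (u.length + 1) :=
            add_le_add (mul_le_mul hxa i1.2 i1.1 h0) i2.2
        _ = S ^ u.length * (x + S) := by ring
        _ ≤ (x + S) ^ u.length * (x + S) := by
            gcongr
            exact le_add_of_nonneg_left h0
        _ = (x + S) ^ (a :: u).length := by rw [List.length_cons, pow_succ]

theorem summable_harm_pow_div (q : ℕ) :
    Summable fun N : ℕ => harm N ^ q / ((N + 1 : ℕ) : ℝ) ^ 2 := by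
  -- Chosen so that `ε q ≤ 1/2`: then `H_N^q` is at most a constant times `(N+1)^(1/2)`, and the
  -- series is dominated by one with exponent `-3/2`.
  set ε : ℝ := 1 / (2 * (q + 1)) with hε
  have hε0 : 0 < ε := by positivity
  have hbound : ∀ N : ℕ, harm N ^ q ≤ (1 + 1 / ε) ^ q * ((N + 1 : ℕ) : ℝ) ^ (1 / 2 : ℝ) := by
    intro N
    have hN1 : (1 : ℝ) ≤ ((N + 1 : ℕ) : ℝ) := by exact_mod_cast Nat.succ_le_succ N.zero_le
    have h1 : harm N ≤ (1 + 1 / ε) * ((N + 1 : ℕ) : ℝ) ^ ε := by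
      calc harm N ≤ harm (N + 1) := harm_mono N.le_succ
        _ ≤ 1 + Real.log ((N + 1 : ℕ) : ℝ) := by
            rw [harm_eq]; exact harmonic_le_one_add_log (N + 1)
        _ ≤ ((N + 1 : ℕ) : ℝ) ^ ε + ((N + 1 : ℕ) : ℝ) ^ ε / ε :=
            add_le_add (Real.one_le_rpow hN1 hε0.le)
              (Real.log_le_rpow_div (by positivity) hε0)
        _ = _ := by ring
    calc harm N ^ q ≤ ((1 + 1 / ε) * ((N + 1 : ℕ) : ℝ) ^ ε) ^ q := by
          gcongr
          exact harm_nonneg N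
      _ = (1 + 1 / ε) ^ q * ((N + 1 : ℕ) : ℝ) ^ (ε * q) := by
          rw [mul_pow, Real.rpow_mul_natCast (by positivity)]
      _ ≤ _ := by
          refine mul_le_mul_of_nonneg_left (Real.rpow_le_rpow_of_exponent_le hN1 ?_)
            (by positivity)
          rw [hε, div_mul_eq_mul_div, div_le_div_iff₀ (by positivity) (by positivity)]
          linarith
  have hs : Summable fun N : ℕ =>
      (1 + 1 / ε) ^ q * (((N + 1 : ℕ) : ℝ) ^ (-(3 / 2 : ℝ))) :=
    ((summable_nat_add_iff 1 (f := fun n : ℕ => ((n : ℝ) ^ (-(3 / 2 : ℝ))))).mpr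
      (Real.summable_nat_rpow.mpr (by norm_num))).mul_left _
  refine Summable.of_nonneg_of_le (fun N => ?_) (fun N => ?_) hs
  · have := harm_nonneg N
    positivity
  · have hN : (0 : ℝ) < ((N + 1 : ℕ) : ℝ) := by positivity
    have hexp : -(3 / 2 : ℝ) + ((2 : ℕ) : ℝ) = 1 / 2 := by norm_num
    rw [div_le_iff₀ (by positivity), mul_assoc, ← Real.rpow_natCast _ 2, ← Real.rpow_add hN, hexp]
    exact hbound N

-- The terms are nonnegative and the truncation boxes eventually contain any finite set of tuples,
-- so the limit of the truncations is the supremum of the finite partial sums.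
open scoped Classical in
theorem mzv_eq_of_tendsto {u : List ℕ+} {L : ℝ}
    (h : Tendsto (fun N => quasiSum u (reciprocals N)) atTop (𝓝 L)) : mzv u = L := by
  let box : ℕ → Finset {m : Fin u.length → ℕ // StrictMono m ∧ ∀ i, 0 < m i} := fun N =>
    ((Fintype.piFinset fun _ : Fin u.length => Finset.Ico 1 (1 + N)).filter StrictMono).subtype _
  have hbox : ∀ N, ∑ m ∈ box N, ∏ i, 1 / ((m.1 i : ℝ) ^ (u.get i : ℕ)) =
      quasiSum u (reciprocals N) := fun N => by
    rw [reciprocals, ← sum_strictMono_eq_quasiSum, Finset.sum_subtype_of_mem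
      (f := fun m : Fin u.length → ℕ => ∏ i, 1 / ((m i : ℝ) ^ (u.get i : ℕ)))]
    · simp only [one_div, inv_pow]
    · intro m hm
      obtain ⟨h1, h2⟩ := Finset.mem_filter.mp hm
      exact ⟨h2, fun i => (Finset.mem_Ico.mp (Fintype.mem_piFinset.mp h1 i)).1⟩
  have hnonneg : ∀ m : {m : Fin u.length → ℕ // StrictMono m ∧ ∀ i, 0 < m i},
      0 ≤ ∏ i, 1 / ((m.1 i : ℝ) ^ (u.get i : ℕ)) := fun m =>
    Finset.prod_nonneg fun i _ => by positivity
  refine (hasSum_of_isLUB_of_nonneg L hnonneg ⟨?_, ?_⟩).tsum_eq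
  · rintro _ ⟨s, rfl⟩
    refine ge_of_tendsto h ?_
    obtain ⟨N₀, hN₀⟩ : ∃ N₀, ∀ m ∈ s, ∀ i, m.1 i ≤ N₀ := by
      refine ⟨s.sup fun m => Finset.univ.sup m.1, fun m hm i => ?_⟩
      exact (Finset.le_sup (f := m.1) (Finset.mem_univ i)).trans
        (Finset.le_sup (f := fun m : {m : Fin u.length → ℕ // StrictMono m ∧ ∀ i, 0 < m i} =>
          Finset.univ.sup m.1) hm)
    filter_upwards [eventually_ge_atTop N₀] with N hN
    rw [← hbox]
    refine Finset.sum_le_sum_of_subset_of_nonneg (fun m hm => ?_) fun m _ _ => hnonneg m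
    simp only [box, Finset.mem_subtype, Finset.mem_filter, Fintype.mem_piFinset, Finset.mem_Ico]
    exact ⟨fun i => ⟨m.2.2 i, by have := hN₀ m hm i; omega⟩, m.2.1⟩
  · intro b hb
    refine le_of_tendsto h (Eventually.of_forall fun N => ?_)
    rw [← hbox]
    exact hb ⟨box N, rfl⟩

/-- `s` has the asymptotic expansion `P(H_N)`, up to an error that is smaller than every power of
the harmonic number `H_N`. -/
def HasExpansion (s : ℕ → ℝ) (P : ℝ[X]) : Prop :=
  ∀ Q : ℝ[X], Tendsto (fun N => (s N - P.eval (harm N)) * Q.eval (harm N)) atTop (𝓝 0)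

namespace HasExpansion

variable {s s' : ℕ → ℝ} {P P' : ℝ[X]}

theorem of_eq (P : ℝ[X]) : HasExpansion (fun N => P.eval (harm N)) P := fun Q => by
  simp

theorem add (h : HasExpansion s P) (h' : HasExpansion s' P') :
    HasExpansion (fun N => s N + s' N) (P + P') := fun Q => by
  have := (h Q).add (h' Q)
  rw [add_zero] at this
  refine this.congr fun N => ?_
  rw [eval_add]
  ring

/-- Errors get multiplied by polynomials in `H_N`, which tend to infinity in general; hence the
demand that they beat every power of `H_N`. -/
theorem mul (h : HasExpansion s P) (h' : HasExpansion s' P') :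
    HasExpansion (fun N => s N * s' N) (P * P') := fun Q => by
  have := (((h 1).mul (h' Q)).add (h (P' * Q))).add (h' (P * Q))
  rw [mul_zero, add_zero, add_zero] at this
  refine this.congr fun N => ?_
  simp only [eval_mul, eval_one]
  ring

theorem sum {ι : Type*} (t : Finset ι) {s : ι → ℕ → ℝ} {P : ι → ℝ[X]}
    (h : ∀ i ∈ t, HasExpansion (s i) (P i)) :
    HasExpansion (fun N => ∑ i ∈ t, s i N) (∑ i ∈ t, P i) := fun Q => by
  have := tendsto_finsetSum t fun i hi => h i hi Q
  rw [Finset.sum_const_zero] at this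
  refine this.congr fun N => ?_
  rw [eval_finsetSum, ← Finset.sum_sub_distrib, Finset.sum_mul]

/-- A polynomial whose values at `H_N → ∞` tend to zero is zero. -/
theorem unique (h : HasExpansion s P) (h' : HasExpansion s P') : P = P' := by
  have h0 : Tendsto (fun N => (P - P').eval (harm N)) atTop (𝓝 0) := by
    have := (h' 1).sub (h 1)
    rw [sub_zero] at this
    refine this.congr fun N => ?_
    simp only [eval_sub, eval_one]
    ring
  rw [← sub_eq_zero]
  by_cases hdeg : 0 < (P - P').degree
  · have h1 := ((P - P').abs_tendsto_atTop hdeg).comp tendsto_harm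
    have h2 := h0.abs
    exact absurd h1 (by
      rw [abs_zero] at h2
      exact not_tendsto_atTop_of_tendsto_nhds h2)
  · rw [eq_C_of_degree_le_zero (not_lt.mp hdeg)] at h0 ⊢
    simp only [eval_C] at h0
    rw [tendsto_nhds_unique tendsto_const_nhds h0, C_0]

end HasExpansion

/-- Since `H_N` increases, `(L - s N) H_N^m` is at most the tail of the increments weighted by their
own `H_n^m`, and tails of the summable `g` tend to zero. -/
theorem tendsto_zero_of_sum_increments {s g : ℕ → ℝ} {L : ℝ} (m : ℕ)
    (hL : Tendsto s atTop (𝓝 L)) (hs : ∀ N, 0 ≤ s (N + 1) - s N)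
    (hg : ∀ N, (s (N + 1) - s N) * harm N ^ m ≤ g N) (hsum : Summable g) :
    Tendsto (fun N => (s N - L) * harm N ^ m) atTop (𝓝 0) := by
  have hd : ∀ N, 0 ≤ L - s N ∧ (L - s N) * harm N ^ m ≤ ∑' n, g (n + N) := fun N => by
    have hmono : Monotone s := monotone_nat_of_le_succ fun n => sub_nonneg.mp (hs n)
    refine ⟨sub_nonneg.mpr (hmono.ge_of_tendsto hL N), ?_⟩
    have hlim : Tendsto (fun n => (s (n + N) - s N) * harm N ^ m) atTop
        (𝓝 ((L - s N) * harm N ^ m)) :=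
      (((tendsto_add_atTop_iff_nat N).mpr hL).sub_const _).mul_const _
    refine le_of_tendsto hlim (Eventually.of_forall fun n => ?_)
    have hg0 : ∀ n, 0 ≤ g n := fun n =>
      (mul_nonneg (hs n) (pow_nonneg (harm_nonneg n) m)).trans (hg n)
    refine le_trans ?_ (((summable_nat_add_iff N).mpr hsum).sum_le_tsum (Finset.range n)
      fun i _ => hg0 _)
    induction n with
    | zero => simp
    | succ n ih =>
      rw [Finset.sum_range_succ]
      have h1 := hg (n + N)
      have h2 : (s (n + N + 1) - s (n + N)) * harm N ^ m ≤
          (s (n + N + 1) - s (n + N)) * harm (n + N) ^ m :=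
        mul_le_mul_of_nonneg_left
          (pow_le_pow_left₀ (harm_nonneg N) (harm_mono (Nat.le_add_left N n)) m) (hs _)
      rw [show n + 1 + N = n + N + 1 by omega]
      linarith
  have h0 : Tendsto (fun N => (L - s N) * harm N ^ m) atTop (𝓝 0) :=
    squeeze_zero (fun N => mul_nonneg (hd N).1 (pow_nonneg (harm_nonneg N) m))
      (fun N => (hd N).2) (tendsto_sum_nat_add g)
  simpa [neg_mul] using h0.neg.congr fun N => (neg_mul _ _).symm

/-- As the last entry is at least `2`, the `N`-th increment of the truncated sum is at most `H_N^q /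
(N+1)²`, with `q` one less than the depth; this stays summable after multiplication by any power of
`H_N`. -/
theorem hasExpansion_of_admissible {u : List ℕ+} (hu : Admissible u) :
    HasExpansion (fun N => quasiSum u (reciprocals N)) (C (mzv u)) := by
  have key : ∃ L, Tendsto (fun N => quasiSum u (reciprocals N)) atTop (𝓝 L) ∧ ∀ m : ℕ,
      Tendsto (fun N => (quasiSum u (reciprocals N) - L) * harm N ^ m) atTop (𝓝 0) := by
    rcases List.eq_nil_or_concat u with rfl | ⟨v, a, rfl⟩
    · exact ⟨1, by simp⟩
    · rw [List.concat_eq_append] at hu ⊢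
      have ha : 2 ≤ (a : ℕ) := by exact_mod_cast admissible_concat.mp hu
      have hinc : ∀ N, quasiSum (v ++ [a]) (reciprocals (N + 1)) -
          quasiSum (v ++ [a]) (reciprocals N) =
          quasiSum v (reciprocals N) * ((N + 1 : ℕ) : ℝ)⁻¹ ^ (a : ℕ) := fun N => by
        rw [reciprocals_succ, quasiSum_concat_concat]
        ring
      have hbd := fun N => quasiSum_nonneg_and_le v (reciprocals N)
        fun x hx => reciprocals_nonneg hx
      have hinc0 : ∀ N, 0 ≤ quasiSum (v ++ [a]) (reciprocals (N + 1)) -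
          quasiSum (v ++ [a]) (reciprocals N) := fun N => by
        rw [hinc]
        exact mul_nonneg (hbd N).1 (by positivity)
      have hincle : ∀ m N, (quasiSum (v ++ [a]) (reciprocals (N + 1)) -
          quasiSum (v ++ [a]) (reciprocals N)) * harm N ^ m ≤
          harm N ^ (v.length + m) / ((N + 1 : ℕ) : ℝ) ^ 2 := fun m N => by
        have h1 : ((N + 1 : ℕ) : ℝ)⁻¹ ^ (a : ℕ) ≤ ((N + 1 : ℕ) : ℝ)⁻¹ ^ 2 :=
          pow_le_pow_of_le_one (by positivity)
            (inv_le_one_of_one_le₀ (by exact_mod_cast Nat.succ_le_succ N.zero_le)) ha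
        have h2 := mul_le_mul (hbd N).2 h1 (by positivity) (pow_nonneg (harm_nonneg N) _)
        rw [hinc, pow_add, div_eq_mul_inv, ← inv_pow, mul_right_comm _ (harm N ^ m)]
        exact mul_le_mul_of_nonneg_right h2 (pow_nonneg (harm_nonneg N) m)
      have hsum0 : Summable fun N => quasiSum (v ++ [a]) (reciprocals (N + 1)) -
          quasiSum (v ++ [a]) (reciprocals N) :=
        Summable.of_nonneg_of_le hinc0 (fun N => by simpa using hincle 0 N)
          (summable_harm_pow_div _)
      have hL := hsum0.hasSum.tendsto_sum_nat
      simp only [Finset.sum_range_sub fun N => quasiSum (v ++ [a]) (reciprocals N)] at hL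
      have h0 : quasiSum (v ++ [a]) (reciprocals 0) = 0 := by
        cases v <;> rfl
      simp only [h0, sub_zero] at hL
      exact ⟨_, hL, fun m => tendsto_zero_of_sum_increments m hL hinc0 (hincle m)
        (summable_harm_pow_div _)⟩
  obtain ⟨L, hL, hm⟩ := key
  rw [mzv_eq_of_tendsto hL]
  intro Q
  have := tendsto_finsetSum (Finset.range (Q.natDegree + 1))
    fun i _ => (hm i).const_mul (Q.coeff i)
  simp only [mul_zero, Finset.sum_const_zero] at this
  refine this.congr fun N => ?_
  rw [eval_C, eval_eq_sum_range, Finset.mul_sum]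
  exact Finset.sum_congr rfl fun i _ => by ring

theorem hasExpansion_of_mem_H0 {f : H1} (hf : f ∈ H0) :
    HasExpansion (fun N => quasiSumₗ (reciprocals N) f) (C ((evalZ f : mzvAlgebra) : ℝ)) := by
  induction hf using Submodule.span_induction with
  | mem f hf =>
    obtain ⟨u, hu, rfl⟩ := hf
    have : ((evalZ (word u) : mzvAlgebra) : ℝ) = mzv u := by
      simp [evalZ, word, mzvElem, hu]
    simpa only [quasiSumₗ_word, this] using hasExpansion_of_admissible hu
  | zero => simpa using HasExpansion.of_eq 0
  | add f g _ _ hf hg => simpa using hf.add hg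
  | smul c f _ hf =>
    have := (HasExpansion.of_eq (C (c : ℝ))).mul hf
    simpa [Algebra.smul_def] using this

/-- Truncation is multiplicative for the harmonic product and sends `e_1` to `H_N`, so a
regularizing expression `∑ aᵢ * e₁^{*i}` becomes the polynomial `∑ Z(aᵢ) Xⁱ`. -/
theorem exists_hasExpansion (u : List ℕ+) :
    ∃ P : ℝ[X], HasExpansion (fun N => quasiSum u (reciprocals N)) P ∧
      P.eval 0 = (zetaReg u : ℝ) := by
  obtain ⟨M, c, hc, hu, h0⟩ := isHarmonicReg_harmonicReg u
  refine ⟨∑ i ∈ Finset.range (M + 1), C ((evalZ (c i) : mzvAlgebra) : ℝ) * X ^ i, ?_, ?_⟩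
  · have := HasExpansion.sum (Finset.range (M + 1)) fun i _ =>
      (hasExpansion_of_mem_H0 (hc i)).mul (HasExpansion.of_eq (X ^ i))
    convert this using 2 with N
    rw [← quasiSumₗ_word, hu, map_sum]
    refine Finset.sum_congr rfl fun i _ => ?_
    rw [harmonicMul_eq, quasiSumₗ_harmonicMulₗ, quasiSumₗ_harmonicPowE1]
    simp [harm]
  · rw [zetaReg, h0, eval_finsetSum, Finset.sum_range_succ']
    simp

theorem zetaReg_eq_mzvElem {u : List ℕ+} (hu : Admissible u) : zetaReg u = mzvElem u := by
  obtain ⟨P, hP, h0⟩ := exists_hasExpansion u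
  rw [hP.unique (hasExpansion_of_admissible hu), eval_C] at h0
  exact Subtype.ext (by rw [← h0, mzvElem, dif_pos hu])

/-! ### The case of the rings `𝒮_n` -/

section ShiftedSums

variable {R : Type*} [CommRing R]

theorem sum_antidiagonalTuple_succ {M : Type*} [AddCommMonoid M] (n d : ℕ)
    (f : (Fin (n + 1) → ℕ) → M) :
    ∑ l ∈ Finset.Nat.antidiagonalTuple (n + 1) d, f l =
      ∑ q ∈ Finset.HasAntidiagonal.antidiagonal d, ∑ l ∈ Finset.Nat.antidiagonalTuple n q.2,
        f (Fin.cons q.1 l) := by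
  rw [Finset.sum_sigma']
  refine Finset.sum_nbij' (fun l => ⟨(l 0, ∑ i, Fin.tail l i), Fin.tail l⟩)
    (fun s => Fin.cons s.1.1 s.2) ?_ ?_ ?_ ?_ ?_
  · intro l hl
    rw [Finset.Nat.mem_antidiagonalTuple, Fin.sum_univ_succ] at hl
    simp only [Finset.mem_sigma, Finset.HasAntidiagonal.mem_antidiagonal, Finset.Nat.mem_antidiagonalTuple,
      and_true]
    exact hl
  · rintro ⟨⟨i, j⟩, l⟩ hs
    simp only [Finset.mem_sigma, Finset.HasAntidiagonal.mem_antidiagonal, Finset.Nat.mem_antidiagonalTuple] at hs ⊢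
    rw [Fin.sum_univ_succ]
    simp only [Fin.cons_zero, Fin.cons_succ]
    rw [hs.2, hs.1]
  · intro l _
    exact Fin.cons_self_tail l
  · rintro ⟨⟨i, j⟩, l⟩ hs
    simp only [Finset.mem_sigma, Finset.HasAntidiagonal.mem_antidiagonal, Finset.Nat.mem_antidiagonalTuple] at hs
    simp [Fin.tail_cons, hs.2]
  · intro l _
    simp [Fin.cons_self_tail]

/-- The positive integer `a + i`. -/
def shiftEntry (a : ℕ+) (i : ℕ) : ℕ+ := ⟨a + i, Nat.add_pos_left a.pos _⟩

theorem shiftEntry_coe (a : ℕ+) (i : ℕ) : (shiftEntry a i : ℕ) = a + i := rfl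

theorem shiftIndex_cons (a : ℕ+) (u : List ℕ+) (i : ℕ) (l : Fin u.length → ℕ) :
    shiftIndex (a :: u) (Fin.cons (n := u.length) i l) =
      shiftEntry a i :: shiftIndex u l :=
  List.ofFn_succ (n := u.length)

/-- The power series `1 / (t - 1/x)`. -/
def shiftedInv (x : R) : PowerSeries R := PowerSeries.mk fun l => -x ^ (l + 1)

/-- The negative binomial series; it is the source of the signs and binomial coefficients in
`zetaHatReg`. -/
theorem shiftedInv_pow (x : R) (a : ℕ+) :
    shiftedInv x ^ (a : ℕ) = (-1) ^ (a : ℕ) *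
      PowerSeries.mk fun d => (((a + d - 1).choose d : ℕ) : R) * x ^ (a + d : ℕ) := by
  obtain ⟨b, hb⟩ : ∃ b, (a : ℕ) = b + 1 := ⟨a - 1, by have := a.pos; omega⟩
  have h1 : shiftedInv x = -(PowerSeries.C x * PowerSeries.rescale x (PowerSeries.mk 1)) := by
    ext l
    simp [shiftedInv, pow_succ']
  rw [h1, neg_pow, mul_pow, ← map_pow, ← map_pow, hb, PowerSeries.mk_one_pow_eq_mk_choose_add]
  congr 1
  ext d
  have h2 : b + 1 + d - 1 = b + d := by omega
  rw [PowerSeries.coeff_C_mul, PowerSeries.coeff_rescale, PowerSeries.coeff_mk,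
    PowerSeries.coeff_mk, h2, Nat.choose_symm_add, pow_add x (b + 1) d]
  ring

/-- The series `∑_l ∏_j binom(u_j + l_j - 1, l_j) M_{u + l} t^{|l|}` at a list of variables. -/
def shiftedSeries (u : List ℕ+) (xs : List R) : PowerSeries R :=
  PowerSeries.mk fun d => ∑ l ∈ Finset.Nat.antidiagonalTuple u.length d,
    ((∏ j, ((u.get j : ℕ) + l j - 1).choose (l j) : ℕ) : R) * quasiSum (shiftIndex u l) xs

theorem shiftedSeries_nil (xs : List R) : shiftedSeries [] xs = 1 := by
  ext d
  cases d with
  | zero =>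
    have : ∀ l, shiftIndex [] l = [] := fun l => rfl
    simp [shiftedSeries, this]
  | succ d => simp [shiftedSeries, PowerSeries.coeff_one]

theorem coeff_shiftedSeries_cons (a : ℕ+) (u : List ℕ+) (xs : List R) (d : ℕ) :
    PowerSeries.coeff d (shiftedSeries (a :: u) xs) =
      ∑ q ∈ Finset.HasAntidiagonal.antidiagonal d, ∑ l ∈ Finset.Nat.antidiagonalTuple u.length q.2,
        ((((a : ℕ) + q.1 - 1).choose q.1 : ℕ) : R) *
          (((∏ j, ((u.get j : ℕ) + l j - 1).choose (l j) : ℕ) : R) *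
            quasiSum (shiftEntry a q.1 :: shiftIndex u l) xs) := by
  rw [shiftedSeries, PowerSeries.coeff_mk]
  refine (sum_antidiagonalTuple_succ u.length d _).trans ?_
  refine Finset.sum_congr rfl fun q _ => Finset.sum_congr rfl fun l _ => ?_
  rw [shiftIndex_cons, ← mul_assoc, ← Nat.cast_mul]
  congr 2
  exact Fin.prod_univ_succ (n := u.length) _

theorem quasiSum_map_shiftedInv (u : List ℕ+) (xs : List R) :
    quasiSum u (xs.map shiftedInv) =
      (-1) ^ (u.map fun a : ℕ+ => (a : ℕ)).sum * shiftedSeries u xs := by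
  induction xs generalizing u with
  | nil =>
    cases u with
    | nil => simp [shiftedSeries_nil]
    | cons a u =>
      have : shiftedSeries (a :: u) ([] : List R) = 0 := by
        ext d
        rw [coeff_shiftedSeries_cons]
        simp
      rw [this]
      simp
  | cons x xs ih =>
    cases u with
    | nil => simp [shiftedSeries_nil]
    | cons a u =>
      have : shiftedSeries (a :: u) (x :: xs) =
          (PowerSeries.mk fun d => (((a + d - 1).choose d : ℕ) : R) * x ^ (a + d : ℕ)) *
            shiftedSeries u xs + shiftedSeries (a :: u) xs := by
        ext d
        rw [map_add, coeff_shiftedSeries_cons, coeff_shiftedSeries_cons, PowerSeries.coeff_mul,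
          ← Finset.sum_add_distrib]
        refine Finset.sum_congr rfl fun q _ => ?_
        rw [shiftedSeries, PowerSeries.coeff_mk, PowerSeries.coeff_mk, Finset.mul_sum,
          ← Finset.sum_add_distrib]
        refine Finset.sum_congr rfl fun l _ => ?_
        rw [quasiSum_cons_cons, shiftEntry_coe]
        ring
      rw [List.map_cons, quasiSum_cons_cons, ih, ih, shiftedInv_pow, this, List.map_cons,
        List.sum_cons, pow_add]
      ring

end ShiftedSums

/-- A sequence of power series has the coefficientwise expansion with constant terms `c`. -/
def HasConstTerm (s : ℕ → PowerSeries ℝ) (c : PowerSeries ℝ) : Prop :=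
  ∃ P : ℕ → Polynomial ℝ, ∀ d, HasExpansion (fun N => PowerSeries.coeff d (s N)) (P d) ∧
    (P d).eval 0 = PowerSeries.coeff d c

namespace HasConstTerm

variable {s s' : ℕ → PowerSeries ℝ} {c c' : PowerSeries ℝ}

theorem const (c : PowerSeries ℝ) : HasConstTerm (fun _ => c) c :=
  ⟨fun d => Polynomial.C (PowerSeries.coeff d c), fun d =>
    ⟨by simpa using HasExpansion.of_eq (Polynomial.C (PowerSeries.coeff d c)), by simp⟩⟩

theorem add (h : HasConstTerm s c) (h' : HasConstTerm s' c') :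
    HasConstTerm (fun N => s N + s' N) (c + c') := by
  obtain ⟨P, hP⟩ := h
  obtain ⟨P', hP'⟩ := h'
  refine ⟨fun d => P d + P' d, fun d => ⟨?_, ?_⟩⟩
  · simpa using (hP d).1.add (hP' d).1
  · simp [(hP d).2, (hP' d).2]

theorem mul (h : HasConstTerm s c) (h' : HasConstTerm s' c') :
    HasConstTerm (fun N => s N * s' N) (c * c') := by
  obtain ⟨P, hP⟩ := h
  obtain ⟨P', hP'⟩ := h'
  refine ⟨fun d => ∑ q ∈ Finset.HasAntidiagonal.antidiagonal d, P q.1 * P' q.2, fun d => ⟨?_, ?_⟩⟩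
  · simp only [PowerSeries.coeff_mul]
    exact HasExpansion.sum _ fun q _ => (hP q.1).1.mul (hP' q.2).1
  · simp [Polynomial.eval_finsetSum, PowerSeries.coeff_mul, (hP _).2, (hP' _).2]

theorem sum {ι : Type*} (t : Finset ι) {s : ι → ℕ → PowerSeries ℝ} {c : ι → PowerSeries ℝ}
    (h : ∀ i ∈ t, HasConstTerm (s i) (c i)) :
    HasConstTerm (fun N => ∑ i ∈ t, s i N) (∑ i ∈ t, c i) := by
  classical
  induction t using Finset.induction_on with
  | empty => simpa using const 0
  | insert i t hi ih =>
    simp only [Finset.sum_insert hi]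
    exact (h i (Finset.mem_insert_self i t)).add
      (ih fun j hj => h j (Finset.mem_insert_of_mem hj))

theorem list_sum {ι : Type*} (t : List ι) {s : ι → ℕ → PowerSeries ℝ} {c : ι → PowerSeries ℝ}
    (h : ∀ i, HasConstTerm (s i) (c i)) :
    HasConstTerm (fun N => (t.map fun i => s i N).sum) (t.map c).sum := by
  induction t with
  | nil => simpa using const 0
  | cons i t ih => simpa using (h i).add ih

theorem unique (h : HasConstTerm s c) (h' : HasConstTerm s c') : c = c' := by
  obtain ⟨P, hP⟩ := h
  obtain ⟨P', hP'⟩ := h'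
  ext d
  rw [← (hP d).2, ← (hP' d).2, (hP d).1.unique (hP' d).1]

end HasConstTerm

/-- The points `1, 1/2, …, 1/N, 1/(t - N), …, 1/(t - 1)`. -/
def symmetricPoints (N : ℕ) : List (PowerSeries ℝ) :=
  (reciprocals N).map PowerSeries.C ++ (reciprocals N).reverse.map shiftedInv

/-- The inclusion of `𝒵⟦t⟧` into `ℝ⟦t⟧`. -/
def toRealSeries : PowerSeries mzvAlgebra →+* PowerSeries ℝ :=
  PowerSeries.map (algebraMap mzvAlgebra ℝ)

theorem toRealSeries_injective : Function.Injective toRealSeries :=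
  PowerSeries.map_injective _ Subtype.val_injective

theorem hasConstTerm_C_zetaReg (u : List ℕ+) :
    HasConstTerm (fun N => quasiSum u ((reciprocals N).map PowerSeries.C))
      (toRealSeries (PowerSeries.C (zetaReg u))) := by
  obtain ⟨P, hP, h0⟩ := exists_hasExpansion u
  refine ⟨fun d => if d = 0 then P else 0, fun d => ?_⟩
  simp only [quasiSum_map, PowerSeries.coeff_C, toRealSeries, PowerSeries.coeff_map]
  split_ifs
  · exact ⟨hP, h0⟩
  · exact ⟨by simpa using HasExpansion.of_eq 0, by simp⟩

theorem hasConstTerm_shiftedSeries (u : List ℕ+) :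
    HasConstTerm (fun N => shiftedSeries u (reciprocals N).reverse)
      (toRealSeries (shiftedReversedSeries u)) := by
  choose P hP h0 using exists_hasExpansion
  refine ⟨fun d => ∑ l ∈ Finset.Nat.antidiagonalTuple u.length d,
    Polynomial.C ((∏ j, ((u.get j : ℕ) + l j - 1).choose (l j) : ℕ) : ℝ) *
      P (shiftIndex u l).reverse, fun d => ⟨?_, ?_⟩⟩
  · simp only [shiftedSeries, PowerSeries.coeff_mk]
    refine HasExpansion.sum _ fun l _ => ?_
    have h := (HasExpansion.of_eq (Polynomial.C
      ((∏ j, ((u.get j : ℕ) + l j - 1).choose (l j) : ℕ) : ℝ))).mul (hP (shiftIndex u l).reverse)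
    simp only [Polynomial.eval_C] at h
    convert h using 3 with N
    rw [← quasiSum_reverse (shiftIndex u l).reverse, List.reverse_reverse]
  · rw [toRealSeries, PowerSeries.coeff_map, shiftedReversedSeries, PowerSeries.coeff_mk, map_sum,
      Polynomial.eval_finsetSum]
    refine Finset.sum_congr rfl fun l _ => ?_
    rw [Polynomial.eval_mul, Polynomial.eval_C, h0, map_mul, map_natCast]
    rfl

/-- Deconcatenation at the middle of `symmetricPoints` gives the sum over `i`. The second half lists
`1/(t-m)` with `m` decreasing, which reverses the remaining index. -/
theorem hasConstTerm_zetaHatReg (u : List ℕ+) :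
    HasConstTerm (fun N => quasiSum u (symmetricPoints N)) (toRealSeries (zetaHatReg u)) := by
  simp only [symmetricPoints, quasiSum_append, zetaHatReg, map_sum, map_mul, map_pow, map_neg,
    map_one, quasiSum_map_shiftedInv]
  refine HasConstTerm.sum _ fun i _ => ?_
  have h := ((HasConstTerm.const ((-1) ^ ((u.drop i).map fun a : ℕ+ => (a : ℕ)).sum)).mul
    (hasConstTerm_C_zetaReg (u.take i))).mul (hasConstTerm_shiftedSeries (u.drop i))
  convert h using 2 with N
  ring

theorem zetaHatReg_newton (k : ℕ+) (r : ℕ) :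
    ((r + 1 : ℕ) : PowerSeries mzvAlgebra) * zetaHatReg (List.replicate (r + 1) k) =
      ∑ j ∈ Finset.range (r + 1),
        (-1) ^ j * zetaHatReg [j.succPNat * k] * zetaHatReg (List.replicate (r - j) k) := by
  apply toRealSeries_injective
  simp only [map_mul, map_sum, map_pow, map_neg, map_one, map_natCast]
  have h1 := (HasConstTerm.const ((r + 1 : ℕ) : PowerSeries ℝ)).mul
    (hasConstTerm_zetaHatReg (List.replicate (r + 1) k))
  simp only [newton_quasiSum] at h1
  exact h1.unique (HasConstTerm.sum _ fun j _ => ((HasConstTerm.const ((-1) ^ j)).mul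
    (hasConstTerm_zetaHatReg [j.succPNat * k])).mul
      (hasConstTerm_zetaHatReg (List.replicate (r - j) k)))

theorem hasConstTerm_sum_commaPlus (u : List ℕ+) :
    HasConstTerm (fun N => quasiSumStar u (symmetricPoints N))
      (toRealSeries ((commaPlus u).map zetaHatReg).sum) := by
  simp only [← sum_commaPlus, map_list_sum, List.map_map]
  exact HasConstTerm.list_sum _ hasConstTerm_zetaHatReg

theorem sum_zetaHatReg_mul (k : ℕ+) (r : ℕ) :
    ∑ i ∈ Finset.range (r + 2), (-1) ^ i * zetaHatReg (List.replicate i k) *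
      ((commaPlus (List.replicate (r + 1 - i) k)).map zetaHatReg).sum = 0 := by
  apply toRealSeries_injective
  rw [map_zero]
  simp only [map_mul, map_sum, map_pow, map_neg, map_one]
  have h1 := HasConstTerm.sum (Finset.range (r + 2)) fun i _ =>
    ((HasConstTerm.const ((-1) ^ i)).mul (hasConstTerm_zetaHatReg (List.replicate i k))).mul
      (hasConstTerm_sum_commaPlus (List.replicate (r + 1 - i) k))
  simp only [sum_quasiSum_mul_quasiSumStar] at h1
  exact h1.unique (HasConstTerm.const 0)

/-! ### Even zeta values modulo `ζ(2)` -/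

theorem mzv_singleton_of_hasSum {a : ℕ+} {L : ℝ}
    (h : HasSum (fun n : ℕ => 1 / (n : ℝ) ^ (a : ℕ)) L) : mzv [a] = L := by
  apply mzv_eq_of_tendsto
  have h1 := (tendsto_add_atTop_iff_nat 1).mpr h.tendsto_sum_nat
  refine h1.congr fun N => ?_
  induction N with
  | zero => simp [reciprocals]
  | succ N ih =>
    rw [Finset.sum_range_succ, ih, reciprocals_succ, quasiSum_singleton, quasiSum_singleton]
    simp

theorem mzv_nil : mzv [] = 1 := mzv_eq_of_tendsto (by simp)

theorem mzvElem_nil : mzvElem [] = 1 := by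
  rw [mzvElem, dif_pos admissible_nil]
  exact Subtype.ext mzv_nil

theorem admissible_singleton {a : ℕ+} (ha : 2 ≤ a) : Admissible [a] :=
  admissible_concat (u := []).mpr ha

theorem coe_mzvElem_singleton {a : ℕ+} (ha : 2 ≤ a) : (mzvElem [a] : ℝ) = mzv [a] := by
  rw [mzvElem, dif_pos (admissible_singleton ha)]

theorem mzvElem_singleton_of_even {a : ℕ+} (ha : Even (a : ℕ)) :
    mzvElem [a] ∈ Ideal.span {mzvElem [2]} := by
  obtain ⟨m, hm⟩ := ha
  have hm0 : m ≠ 0 := by have := a.pos; omega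
  have ha2 : 2 ≤ a := by
    rw [← PNat.coe_le_coe]
    change 2 ≤ (a : ℕ)
    omega
  have h2 : mzv [2] = Real.pi ^ 2 / 6 := mzv_singleton_of_hasSum hasSum_zeta_two
  have h1 : mzv [a] = (-1 : ℝ) ^ (m + 1) * (2 : ℝ) ^ (2 * m - 1) * Real.pi ^ (2 * m) *
      _root_.bernoulli (2 * m) / (2 * m).factorial := by
    refine mzv_singleton_of_hasSum ?_
    rw [hm, ← two_mul]
    exact hasSum_zeta_nat hm0
  -- Euler's coefficient of `π^(2m)`, with `6^m` coming from `π² = 6 ζ(2)`.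
  let q : ℚ := (-1) ^ (m + 1) * 2 ^ (2 * m - 1) * 6 ^ m * _root_.bernoulli (2 * m) / (2 * m).factorial
  have hq : mzvElem [a] = algebraMap ℚ mzvAlgebra q * mzvElem [2] ^ m := by
    apply Subtype.ext
    change (mzvElem [a] : ℝ) = (q : ℝ) * (mzvElem [2] : ℝ) ^ m
    rw [coe_mzvElem_singleton ha2, coe_mzvElem_singleton le_rfl, h1, h2]
    push_cast [q]
    rw [pow_mul, div_pow]
    field_simp
  rw [hq]
  exact Ideal.mul_mem_left _ _ (Ideal.pow_mem_of_mem _ (Ideal.mem_span_singleton_self _) m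
    (Nat.pos_of_ne_zero hm0))

theorem shiftEntry_eq_toPNat' (a : ℕ+) (d : ℕ) : shiftEntry a d = (a + d : ℕ).toPNat' :=
  PNat.eq (by rw [Nat.toPNat'_coe, if_pos (Nat.add_pos_left a.pos _)]; rfl)

theorem coeff_zetaHatReg_singleton (a : ℕ+) (d : ℕ) :
    PowerSeries.coeff d (zetaHatReg [a]) =
      (-1) ^ (a : ℕ) * (((a + d - 1).choose d : ℕ) : mzvAlgebra) * zetaReg [shiftEntry a d] +
      if d = 0 then zetaReg [a] else 0 := by
  have hnil : ∀ l, shiftIndex [] l = [] := fun l => rfl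
  have hsrs : shiftedReversedSeries [] = 1 := by
    ext e
    cases e with
    | zero =>
      simp [shiftedReversedSeries, hnil, zetaReg_eq_mzvElem admissible_nil, mzvElem_nil]
    | succ e => simp [shiftedReversedSeries, PowerSeries.coeff_one]
  have hsrs1 : PowerSeries.coeff d (shiftedReversedSeries [a]) =
      (((a + d - 1).choose d : ℕ) : mzvAlgebra) * zetaReg [shiftEntry a d] := by
    rw [shiftedReversedSeries, PowerSeries.coeff_mk]
    change ∑ l ∈ Finset.Nat.antidiagonalTuple 1 d, _ = _
    rw [Finset.Nat.antidiagonalTuple_one, Finset.sum_singleton]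
    have : (shiftIndex [a] ![d]).reverse = [shiftEntry a d] := rfl
    rw [this]
    simp
  have hpow : ((-1 : PowerSeries mzvAlgebra) ^ (a : ℕ)) = PowerSeries.C ((-1) ^ (a : ℕ)) := by
    simp
  rw [zetaHatReg]
  simp only [List.length_singleton, Finset.sum_range_succ, Finset.sum_range_zero, List.drop_zero,
    List.take_zero, List.map_singleton, List.sum_singleton, zetaReg_eq_mzvElem admissible_nil,
    mzvElem_nil, map_one, mul_one, zero_add, List.drop_one, List.tail_cons, List.map_nil,
    List.sum_nil, pow_zero, one_mul, hsrs, map_add, hpow, PowerSeries.coeff_C_mul, hsrs1,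
    List.take_succ_cons, PowerSeries.coeff_C]
  rw [mul_assoc]

theorem zetaReg_singleton {a : ℕ+} (ha : 2 ≤ (a : ℕ)) : zetaReg [a] = mzvElem [a] :=
  zetaReg_eq_mzvElem (admissible_singleton (by rwa [← PNat.coe_le_coe]))

theorem zetaHatReg_nil : zetaHatReg [] = 1 := by
  apply toRealSeries_injective
  rw [map_one]
  have := hasConstTerm_zetaHatReg []
  simp only [quasiSum_nil] at this
  exact this.unique (HasConstTerm.const 1)

/-! ### Depth-one values and closed forms after reduction modulo `ζ(2)` and a power of `t`. -/

section Quotients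

variable {K S : Type*} [CommRing K] [CommRing S]

/-- The factor `2` absorbs the halves of the quadratic coefficient, so `K` need not be a
`ℚ`-algebra. -/
theorem two_mul_map_eq_of_coeff (π : PowerSeries K →+* S) (hπ : π PowerSeries.X ^ 3 = 0)
    (f : PowerSeries K) (c₁ c₂ : K) (h0 : PowerSeries.coeff 0 f = 0)
    (h1 : PowerSeries.coeff 1 f = c₁) (h2 : 2 * PowerSeries.coeff 2 f = c₂) :
    2 * π f = 2 * (π (PowerSeries.C c₁) * π PowerSeries.X) +
      π (PowerSeries.C c₂) * π PowerSeries.X ^ 2 := by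
  have hdvd : (PowerSeries.X : PowerSeries K) ^ 3 ∣ 2 * f -
      (2 * (PowerSeries.C c₁ * PowerSeries.X) + PowerSeries.C c₂ * PowerSeries.X ^ 2) := by
    rw [PowerSeries.X_pow_dvd_iff]
    intro d hd
    have htwo : (2 : PowerSeries K) = PowerSeries.C 2 := (map_ofNat _ 2).symm
    rw [htwo]
    simp only [map_sub, map_add, PowerSeries.coeff_C_mul, PowerSeries.coeff_X,
      PowerSeries.coeff_X_pow]
    interval_cases d
    · simp only [h0]
      simp
    · simp [h1]
    · simp [h2]
  obtain ⟨g, hg⟩ := hdvd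
  have h := congrArg π hg
  simp only [map_sub, map_add, map_mul, map_pow, map_ofNat, hπ, zero_mul] at h
  exact sub_eq_zero.mp h

variable (φ : mzvAlgebra →+* K) (π : PowerSeries K →+* S)

/-- The image of `ζ(j)`. -/
def zetaImage (j : ℕ) : S := π (PowerSeries.C (φ (mzvElem [j.toPNat'])))

theorem zetaImage_eq_zero (hφ : ∀ a : ℕ+, Even (a : ℕ) → φ (mzvElem [a]) = 0)
    {j : ℕ} (hj : Even j) (h0 : 0 < j) : zetaImage φ π j = 0 := by
  rw [zetaImage, hφ _ (by rwa [Nat.toPNat'_coe, if_pos h0]), map_zero, map_zero]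

theorem two_mul_map_zetaHatReg_singleton
    (hφ : ∀ a : ℕ+, Even (a : ℕ) → φ (mzvElem [a]) = 0)
    (hπ : π PowerSeries.X ^ 3 = 0) (a : ℕ+) :
    2 * π (PowerSeries.map φ (zetaHatReg [a])) = (-1) ^ (a : ℕ) *
      (2 * ((a : ℕ) : S) * (zetaImage φ π (a + 1) * π PowerSeries.X) +
      ((a : ℕ) : S) * ((a + 1 : ℕ) : S) * (zetaImage φ π (a + 2) * π PowerSeries.X ^ 2)) := by
  have hapos := a.pos
  rw [two_mul_map_eq_of_coeff π hπ _ ((-1) ^ (a : ℕ) * ((a : ℕ) : K) *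
    φ (mzvElem [(a + 1 : ℕ).toPNat'])) ((-1) ^ (a : ℕ) * (((a : ℕ) : K) * ((a + 1 : ℕ) : K)) *
    φ (mzvElem [(a + 2 : ℕ).toPNat']))]
  · simp only [map_mul, map_pow, map_neg, map_one, map_natCast, zetaImage]
    ring
  · have ha : shiftEntry a 0 = a := rfl
    rw [PowerSeries.coeff_map, coeff_zetaHatReg_singleton, ha, if_pos rfl]
    simp only [Nat.choose_zero_right, Nat.cast_one, mul_one, map_add, map_mul, map_pow, map_neg,
      map_one]
    -- The constant coefficient is `((-1)^a + 1) ζ^*(a)`: it vanishes modulo `ζ(2)` for even `a` and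
    -- cancels for odd `a`, including the regularized `a = 1`.
    rcases Nat.even_or_odd (a : ℕ) with hev | hodd
    · rw [zetaReg_singleton (by obtain ⟨m, hm⟩ := hev; omega), hφ a hev]
      simp
    · rw [hodd.neg_one_pow]
      simp
  · rw [PowerSeries.coeff_map, coeff_zetaHatReg_singleton, if_neg one_ne_zero,
      zetaReg_singleton (a := shiftEntry a 1) (show 2 ≤ (a : ℕ) + 1 by omega), shiftEntry_eq_toPNat']
    simp
  · rw [PowerSeries.coeff_map, coeff_zetaHatReg_singleton, if_neg two_ne_zero,
      zetaReg_singleton (a := shiftEntry a 2) (show 2 ≤ (a : ℕ) + 2 by omega), shiftEntry_eq_toPNat']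
    have hch : (2 : K) * (((a : ℕ) + 2 - 1).choose 2 : ℕ) =
        ((a : ℕ) : K) * ((a + 1 : ℕ) : K) := by
      have : 2 * ((a : ℕ) + 2 - 1).choose 2 = a * (a + 1) := by
        rw [show (a : ℕ) + 2 - 1 = a + 1 by omega, Nat.choose_two_right, Nat.add_sub_cancel,
          mul_comm ((a : ℕ) + 1), Nat.mul_div_cancel' (Nat.even_mul_succ_self a).two_dvd]
      exact_mod_cast congrArg (Nat.cast (R := K)) this
    simp only [map_mul, map_pow, map_neg, map_one, map_natCast, add_zero]
    linear_combination (-1) ^ (a : ℕ) * φ (mzvElem [(a + 2 : ℕ).toPNat']) * hch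

variable [Algebra ℚ S]

theorem map_zetaHatReg_of_sq_eq_zero
    (hφ : ∀ a : ℕ+, Even (a : ℕ) → φ (mzvElem [a]) = 0)
    (hπ : π PowerSeries.X ^ 2 = 0) (r : ℕ) (hr : 0 < r) (k : ℕ+) :
    π (PowerSeries.map φ (zetaHatReg (List.replicate r k))) =
        ((-1) ^ (r - 1) * (k : ℚ)) • (zetaImage φ π (r * k + 1) * π PowerSeries.X) ∧
      π (PowerSeries.map φ ((commaPlus (List.replicate r k)).map zetaHatReg).sum) =
        (k : ℚ) • (zetaImage φ π (r * k + 1) * π PowerSeries.X) := by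
  refine closed_form_of_sq_eq_zero
    (e := fun i => π (PowerSeries.map φ (zetaHatReg (List.replicate i k))))
    (h := fun i => π (PowerSeries.map φ ((commaPlus (List.replicate i k)).map zetaHatReg).sum))
    (P := fun j => π (PowerSeries.map φ (zetaHatReg [(j - 1).succPNat * k])))
    (D := zetaImage φ π) (k : ℕ) hπ ?_ ?_ (fun n => ?_) (fun n => ?_) (fun j => ?_) r hr
  · simp [zetaHatReg_nil]
  · simp [commaPlus, zetaHatReg_nil]
  · have := congrArg (π.comp (PowerSeries.map φ)) (zetaHatReg_newton k n)
    simpa only [map_mul, map_sum, map_pow, map_neg, map_one, map_natCast, RingHom.comp_apply,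
      Nat.add_sub_cancel]
      using this
  · have := congrArg (π.comp (PowerSeries.map φ)) (sum_zetaHatReg_mul k n)
    simpa only [map_mul, map_sum, map_pow, map_neg, map_one, map_zero, RingHom.comp_apply]
      using this
  · apply two_mul_cancel
    rw [two_mul_map_zetaHatReg_singleton φ π hφ (pow_eq_zero_of_le (by norm_num) hπ), hπ]
    simp only [PNat.mul_coe, Nat.succPNat_coe, Nat.add_sub_cancel, Nat.succ_eq_add_one]
    -- The sign `(-1)^((j+1)k)` can be dropped: when it is `-1`, the zeta value has even argument
    -- and vanishes.
    rcases Nat.even_or_odd ((j + 1) * (k : ℕ)) with hev | hodd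
    · rw [hev.neg_one_pow]
      ring
    · rw [zetaImage_eq_zero φ π hφ hodd.add_one (Nat.succ_pos _)]
      ring

theorem map_zetaHatReg_of_cube_eq_zero
    (hφ : ∀ a : ℕ+, Even (a : ℕ) → φ (mzvElem [a]) = 0)
    (hπ : π PowerSeries.X ^ 3 = 0) (r : ℕ) (hr : 0 < r) (k : ℕ+) :
    π (PowerSeries.map φ (zetaHatReg (List.replicate r k))) =
        ((-1) ^ (r * k + r - 1) : ℚ) •
          ((k : ℚ) • (zetaImage φ π (r * k + 1) * π PowerSeries.X) +
            (((k : ℚ) * (r * k + 1) / 2) • zetaImage φ π (r * k + 2) -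
              ((k : ℚ) ^ 2 / 2) • ∑ l ∈ Finset.Icc 1 (r - 1),
                zetaImage φ π (l * k + 1) * zetaImage φ π ((r - l) * k + 1)) *
                  π PowerSeries.X ^ 2) ∧
      π (PowerSeries.map φ ((commaPlus (List.replicate r k)).map zetaHatReg).sum) =
        ((-1) ^ (r * k) : ℚ) •
          ((k : ℚ) • (zetaImage φ π (r * k + 1) * π PowerSeries.X) +
            (((k : ℚ) * (r * k + 1) / 2) • zetaImage φ π (r * k + 2) +
              ((k : ℚ) ^ 2 / 2) • ∑ l ∈ Finset.Icc 1 (r - 1),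
                zetaImage φ π (l * k + 1) * zetaImage φ π ((r - l) * k + 1)) *
                  π PowerSeries.X ^ 2) := by
  refine closed_form_of_cube_eq_zero
    (e := fun i => π (PowerSeries.map φ (zetaHatReg (List.replicate i k))))
    (h := fun i => π (PowerSeries.map φ ((commaPlus (List.replicate i k)).map zetaHatReg).sum))
    (P := fun j => π (PowerSeries.map φ (zetaHatReg [(j - 1).succPNat * k])))
    (D := zetaImage φ π) (k : ℕ) hπ ?_ ?_ (fun n => ?_) (fun n => ?_) (fun j => ?_) r hr
  · simp [zetaHatReg_nil]
  · simp [commaPlus, zetaHatReg_nil]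
  · have := congrArg (π.comp (PowerSeries.map φ)) (zetaHatReg_newton k n)
    simpa only [map_mul, map_sum, map_pow, map_neg, map_one, map_natCast, RingHom.comp_apply,
      Nat.add_sub_cancel]
      using this
  · have := congrArg (π.comp (PowerSeries.map φ)) (sum_zetaHatReg_mul k n)
    simpa only [map_mul, map_sum, map_pow, map_neg, map_one, map_zero, RingHom.comp_apply]
      using this
  · rw [two_mul_map_zetaHatReg_singleton φ π hφ hπ]
    simp only [PNat.mul_coe, Nat.succPNat_coe, Nat.add_sub_cancel, Nat.succ_eq_add_one]

end Quotients

theorem SRing.proj_X_pow_self (n : ℕ) : SRing.proj n PowerSeries.X ^ n = 0 := by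
  rw [← map_pow]
  exact Ideal.Quotient.eq_zero_iff_mem.mpr (Ideal.mem_span_singleton_self _)

theorem mk_mzvElem_singleton_of_even (a : ℕ+) (ha : Even (a : ℕ)) :
    Ideal.Quotient.mk (Ideal.span {mzvElem [2]}) (mzvElem [a]) = 0 :=
  Ideal.Quotient.eq_zero_iff_mem.mpr (mzvElem_singleton_of_even ha)

theorem zetaStarHat_eq (u : List ℕ+) :
    zetaStarHat u = PowerSeries.map (Ideal.Quotient.mk (Ideal.span {mzvElem [2]}))
      ((commaPlus u).map zetaHatReg).sum := by
  rw [zetaStarHat, map_list_sum, List.map_map]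
  rfl

theorem zetaS_two_replicate (r : ℕ) (hr : 0 < r) (k : ℕ+) :
    zetaS 2 (List.replicate r k) =
        ((-1) ^ (r - 1) * (k : ℚ)) • (depthOneS 2 (r * k + 1) * xS 2) ∧
      zetaStarS 2 (List.replicate r k) = (k : ℚ) • (depthOneS 2 (r * k + 1) * xS 2) := by
  rw [zetaStarS, zetaStarHat_eq]
  exact map_zetaHatReg_of_sq_eq_zero (K := ZBar) (S := SRing 2)
    (Ideal.Quotient.mk (Ideal.span {mzvElem [2]})) (SRing.proj 2) mk_mzvElem_singleton_of_even
    (SRing.proj_X_pow_self 2) r hr k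

theorem zetaS_three_replicate (r : ℕ) (hr : 0 < r) (k : ℕ+) :
    zetaS 3 (List.replicate r k) =
        ((-1) ^ (r * k + r - 1) : ℚ) •
          ((k : ℚ) • (depthOneS 3 (r * k + 1) * xS 3) +
            (((k : ℚ) * (r * k + 1) / 2) • depthOneS 3 (r * k + 2) -
              ((k : ℚ) ^ 2 / 2) • ∑ l ∈ Finset.Icc 1 (r - 1),
                depthOneS 3 (l * k + 1) * depthOneS 3 ((r - l) * k + 1)) * xS 3 ^ 2) ∧
      zetaStarS 3 (List.replicate r k) =
        ((-1) ^ (r * k) : ℚ) •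
          ((k : ℚ) • (depthOneS 3 (r * k + 1) * xS 3) +
            (((k : ℚ) * (r * k + 1) / 2) • depthOneS 3 (r * k + 2) +
              ((k : ℚ) ^ 2 / 2) • ∑ l ∈ Finset.Icc 1 (r - 1),
                depthOneS 3 (l * k + 1) * depthOneS 3 ((r - l) * k + 1)) * xS 3 ^ 2) := by
  rw [zetaStarS, zetaStarHat_eq]
  exact map_zetaHatReg_of_cube_eq_zero (K := ZBar) (S := SRing 3)
    (Ideal.Quotient.mk (Ideal.span {mzvElem [2]})) (SRing.proj 3) mk_mzvElem_singleton_of_even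
    (SRing.proj_X_pow_self 3) r hr k

end FMZV

end

open FMZV in
theorem mainTheorem6 (r : ℕ) (hr : 0 < r) (k : ℕ+) :
    -- the case `ℱ = 𝒜`
    (zetaA 2 (List.replicate r k) =
        ((-1) ^ (r - 1) * (k : ℚ)) • (depthOneA 2 (r * k + 1) * xA 2) ∧
      zetaStarA 2 (List.replicate r k) = (k : ℚ) • (depthOneA 2 (r * k + 1) * xA 2) ∧
      zetaA 3 (List.replicate r k) =
        ((-1) ^ (r * k + r - 1) : ℚ) •
          ((k : ℚ) • (depthOneA 3 (r * k + 1) * xA 3) +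
            (((k : ℚ) * (r * k + 1) / 2) • depthOneA 3 (r * k + 2) -
              ((k : ℚ) ^ 2 / 2) • ∑ l ∈ Finset.Icc 1 (r - 1),
                depthOneA 3 (l * k + 1) * depthOneA 3 ((r - l) * k + 1)) * xA 3 ^ 2) ∧
      zetaStarA 3 (List.replicate r k) =
        ((-1) ^ (r * k) : ℚ) •
          ((k : ℚ) • (depthOneA 3 (r * k + 1) * xA 3) +
            (((k : ℚ) * (r * k + 1) / 2) • depthOneA 3 (r * k + 2) +
              ((k : ℚ) ^ 2 / 2) • ∑ l ∈ Finset.Icc 1 (r - 1),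
                depthOneA 3 (l * k + 1) * depthOneA 3 ((r - l) * k + 1)) * xA 3 ^ 2)) ∧
    -- the case `ℱ = 𝒮`
    (zetaS 2 (List.replicate r k) =
        ((-1) ^ (r - 1) * (k : ℚ)) • (depthOneS 2 (r * k + 1) * xS 2) ∧
      zetaStarS 2 (List.replicate r k) = (k : ℚ) • (depthOneS 2 (r * k + 1) * xS 2) ∧
      zetaS 3 (List.replicate r k) =
        ((-1) ^ (r * k + r - 1) : ℚ) •
          ((k : ℚ) • (depthOneS 3 (r * k + 1) * xS 3) +
            (((k : ℚ) * (r * k + 1) / 2) • depthOneS 3 (r * k + 2) -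
              ((k : ℚ) ^ 2 / 2) • ∑ l ∈ Finset.Icc 1 (r - 1),
                depthOneS 3 (l * k + 1) * depthOneS 3 ((r - l) * k + 1)) * xS 3 ^ 2) ∧
      zetaStarS 3 (List.replicate r k) =
        ((-1) ^ (r * k) : ℚ) •
          ((k : ℚ) • (depthOneS 3 (r * k + 1) * xS 3) +
            (((k : ℚ) * (r * k + 1) / 2) • depthOneS 3 (r * k + 2) +
              ((k : ℚ) ^ 2 / 2) • ∑ l ∈ Finset.Icc 1 (r - 1),
                depthOneS 3 (l * k + 1) * depthOneS 3 ((r - l) * k + 1)) * xS 3 ^ 2)) := by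
  exact ⟨⟨(zetaA_two_replicate r hr k).1, (zetaA_two_replicate r hr k).2,
      (zetaA_three_replicate r hr k).1, (zetaA_three_replicate r hr k).2⟩,
    ⟨(zetaS_two_replicate r hr k).1, (zetaS_two_replicate r hr k).2,
      (zetaS_three_replicate r hr k).1, (zetaS_three_replicate r hr k).2⟩⟩
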